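/- Let $R$ be a unital ring and let $\mathcal{B}$ be an additive full subcategory of the category of finitely presented left $R$-modules. Let $\varinjlim\mathcal{B}$ denote the class of left $R$-modules that are (small) filtered colimits of modules from $\mathcal{B}$, and let $(\mathrm{Mod}\text{-}R)^{\mathcal{B}}$ denote the class of right $R$-modules that are direct summands of arbitrary (set-indexed) products of modules of the form $\operatorname{Hom}_{\mathbb{Z}}(B,\mathbb{Q}/\mathbb{Z})$ with $B\in\mathcal{B}$. Call $R$ \emph{$\mathcal{B}$-coherent} if $\varinjlim\mathcal{B}$ is closed under arbitrary products of left $R$-modules, and call $R$ \emph{$\mathcal{B}$-noetherian} if $(\mathrm{Mod}\text{-}R)^{\mathcal{B}}$ is closed under arbitrary coproducts (direct sums) of right $R$-modules. Assume that the left $R$-module $R$ belongs to $\varinjlim\mathcal{B}$. Then $R$ is $\mathcal{B}$-noetherian if and only if both of the following conditions hold: (1) $R$ is $\mathcal{B}$-coherent; (2) for every right $R$-module $E$, one has $E\in(\mathrm{Mod}\text{-}R)^{\mathcal{B}}$ if and only if the left $R$-module $\operatorname{Hom}_{\mathbb{Z}}(E,\mathbb{Q}/\mathbb{Z})$ belongs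 to $\varinjlim\mathcal{B}$. -/

import Mathlib

universe u

namespace CosupportModules

open CategoryTheory MulOpposite
open scoped DirectSum

/-- For a left `R`-module `M`, the right `R`-module structure (a left `Rᵐᵒᵖ`-module structure) on
the group `Hom_ℤ(M, ℚ/ℤ)`, given by `(f · r) x = f (r x)`. -/
@[reducible] def charRightModule (R : Type u) [Ring R] (M : Type u) [AddCommGroup M]
    [Module R M] : Module Rᵐᵒᵖ (CharacterModule M) where
  smul r f := AddMonoidHom.comp f (Module.toAddMonoidEnd R M (unop r))
  one_smul f := CharacterModule.ext _ fun x =>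
    show f ((1 : R) • x) = f x by rw [one_smul]
  mul_smul r s f := CharacterModule.ext _ fun x =>
    show f ((unop s * unop r) • x) = f (unop s • unop r • x) by rw [mul_smul]
  smul_zero _ := rfl
  smul_add _ _ _ := rfl
  add_smul r s f := CharacterModule.ext _ fun x =>
    show f ((unop r + unop s) • x) = f (unop r • x) + f (unop s • x) by
      rw [add_smul]; exact map_add f _ _
  zero_smul f := CharacterModule.ext _ fun x =>
    show f ((0 : R) • x) = 0 by rw [zero_smul]; exact map_zero f

/-- For a right `R`-module `E` (a left `Rᵐᵒᵖ`-module), the left `R`-module structure on the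
group `Hom_ℤ(E, ℚ/ℤ)`, given by `(r · f) x = f (x r)`. -/
@[reducible] def charLeftModule (R : Type u) [Ring R] (E : Type u) [AddCommGroup E]
    [Module Rᵐᵒᵖ E] : Module R (CharacterModule E) where
  smul r f := AddMonoidHom.comp f (Module.toAddMonoidEnd Rᵐᵒᵖ E (op r))
  one_smul f := CharacterModule.ext _ fun x =>
    show f ((1 : Rᵐᵒᵖ) • x) = f x by rw [one_smul]
  mul_smul r s f := CharacterModule.ext _ fun x =>
    show f ((op s * op r) • x) = f (op s • op r • x) by rw [mul_smul]
  smul_zero _ := rfl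
  smul_add _ _ _ := rfl
  add_smul r s f := CharacterModule.ext _ fun x =>
    show f ((op r + op s) • x) = f (op r • x) + f (op s • x) by
      rw [add_smul]; exact map_add f _ _
  zero_smul f := CharacterModule.ext _ fun x =>
    show f ((0 : Rᵐᵒᵖ) • x) = 0 by rw [zero_smul]; exact map_zero f

variable {R : Type u} [Ring R]

/-- The right `R`-module `Hom_ℤ(M, ℚ/ℤ)` of a left `R`-module `M`. -/
def charRight (M : ModuleCat.{u} R) : ModuleCat.{u} Rᵐᵒᵖ :=
  letI := charRightModule R M
  ModuleCat.of Rᵐᵒᵖ (CharacterModule M)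

/-- The left `R`-module `Hom_ℤ(E, ℚ/ℤ)` of a right `R`-module `E`. -/
def charLeft (E : ModuleCat.{u} Rᵐᵒᵖ) : ModuleCat.{u} R :=
  letI := charLeftModule R E
  ModuleCat.of R (CharacterModule E)

/-- `𝓑` is (the class of objects of) an additive full subcategory of the category of finitely
presented left `R`-modules. It need not be closed under isomorphisms or direct summands. -/
structure IsAdditiveFPSubcategory (𝓑 : ObjectProperty (ModuleCat.{u} R)) : Prop where
  finitePresentation : ∀ M : ModuleCat.{u} R, 𝓑 M → Module.FinitePresentation R M
  exists_zero : ∃ Z : ModuleCat.{u} R, 𝓑 Z ∧ Subsingleton Z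
  exists_sum : ∀ M N : ModuleCat.{u} R, 𝓑 M → 𝓑 N →
    ∃ P : ModuleCat.{u} R, 𝓑 P ∧ Nonempty (P ≃ₗ[R] (M × N))

/-- `lim→ 𝓑`: the modules which are filtered colimits of modules from `𝓑`, over small filtered
index categories. -/
def limClosure (𝓑 : ObjectProperty (ModuleCat.{u} R)) : ObjectProperty (ModuleCat.{u} R) :=
  ObjectProperty.ind.{u} 𝓑

/-- `Prod 𝓒`: the direct summands of arbitrary (set-indexed) products of modules from `𝓒`. -/
def prodClosure {S : Type u} [Ring S] (𝓒 : ObjectProperty (ModuleCat.{u} S)) :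
    ObjectProperty (ModuleCat.{u} S) := fun N =>
  ∃ (ι : Type u) (X : ι → ModuleCat.{u} S), (∀ i, 𝓒 (X i)) ∧
    ∃ (s : N →ₗ[S] (∀ i, X i)) (p : (∀ i, X i) →ₗ[S] N), p ∘ₗ s = LinearMap.id

/-- The class `{Hom_ℤ(B, ℚ/ℤ) | B ∈ 𝓑}` of right `R`-modules, up to isomorphism. -/
def charDuals (𝓑 : ObjectProperty (ModuleCat.{u} R)) : ObjectProperty (ModuleCat.{u} Rᵐᵒᵖ) :=
  fun N => ∃ B : ModuleCat.{u} R, 𝓑 B ∧ Nonempty (N ≃ₗ[Rᵐᵒᵖ] charRight B)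

/-- `(Mod-R)^𝓑`: the right `R`-modules with cosupport in `𝓑`. -/
def cosupport (𝓑 : ObjectProperty (ModuleCat.{u} R)) : ObjectProperty (ModuleCat.{u} Rᵐᵒᵖ) :=
  prodClosure (charDuals 𝓑)

/-- `R` is `𝓑`-coherent: `lim→ 𝓑` is closed under products of left `R`-modules. -/
def IsCoherentFor (𝓑 : ObjectProperty (ModuleCat.{u} R)) : Prop :=
  ∀ (ι : Type u) (X : ι → ModuleCat.{u} R), (∀ i, limClosure 𝓑 (X i)) →
    limClosure 𝓑 (ModuleCat.of R (∀ i, X i))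

/-- `R` is `𝓑`-noetherian: `(Mod-R)^𝓑` is closed under coproducts of right `R`-modules. -/
def IsNoetherianFor (𝓑 : ObjectProperty (ModuleCat.{u} R)) : Prop :=
  ∀ (ι : Type u) (X : ι → ModuleCat.{u} Rᵐᵒᵖ), (∀ i, cosupport 𝓑 (X i)) →
    cosupport 𝓑 (ModuleCat.of Rᵐᵒᵖ (⨁ i, X i))

end CosupportModules

namespace CosupportModules

open CategoryTheory MulOpposite
open scoped DirectSum

-- Write `X*` for `Hom_ℤ(X, ℚ/ℤ)`. Conditions (1) and (2) give the noetherian property at once,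
-- because `(⨁ Xᵢ)* ≅ ∏ Xᵢ*` (`charLeftDirectSum`).
--
-- For the other direction, closing `𝓑` under retracts changes neither `lim→ 𝓑` nor the cosupport
-- class, and it puts `R` itself into `𝓑`. If `⨁ Dₙ*` has cosupport in `𝓑`, then it splits off `∏
-- Dₙ*`, since maps from the sum to `B*` extend to the product for `B` finitely presented. This
-- splitting forces an ascending chain condition on maps out of an object of `𝓑`, ordered by
-- factorization (`exists_factor_succ`). Hence any property of such maps that is stable under
-- pairing has a generating map (`exists_generating_map`), and in particular `𝓑` has weak cokernels.
--
-- A weak cokernel in `𝓑` also serves for maps into modules of `lim→ 𝓑`. One and the same weak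
-- cokernel works for all factors of a product, which gives coherence. Dualizing the exactness it
-- expresses twice shows `E* ∈ lim→ 𝓑` for `E` with cosupport in `𝓑`.
--
-- If conversely `E* ∈ lim→ 𝓑`, map `E` by `η` to the product of all `B*` over all maps `E → B*`.
-- Then `η ⊗ B` is injective for `B ∈ 𝓑`. Zorn's lemma gives a maximal `K` with `K ⊗ B` and `η(E) ⊗
-- B` meeting trivially for all `B`, and generating maps out of `R` show that `K` is a complement of
-- `η(E)` (`IsPureFor.exists_isCompl_range`).

attribute [local instance] charRightModule charLeftModule

/-! ### Characters of abelian groups -/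

section Characters

variable {G H : Type*} [AddCommGroup G] [AddCommGroup H]

/-- Injectivity of `ℚ/ℤ`, applied to the embedding of `G / ker f` into `H`. -/
lemma exists_character_factor (f : G →+ H) (φ : CharacterModule G)
    (h : ∀ x, f x = 0 → φ x = 0) : ∃ ψ : CharacterModule H, ∀ x, ψ (f x) = φ x := by
  let φ' : G →ₗ[ℤ] AddCircle (1 : ℚ) := AddMonoidHom.toIntLinearMap φ
  let F : G →ₗ[ℤ] H := f.toIntLinearMap
  let φq : (G ⧸ LinearMap.ker F) →ₗ[ℤ] AddCircle (1 : ℚ) :=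
    (LinearMap.ker F).liftQ φ' fun x hx => h x hx
  let Fq : (G ⧸ LinearMap.ker F) →ₗ[ℤ] H := (LinearMap.ker F).liftQ F le_rfl
  have hFq : Function.Injective Fq := by
    rw [← LinearMap.ker_eq_bot]
    exact Submodule.ker_liftQ_eq_bot _ _ _ le_rfl
  obtain ⟨ψ, hψ⟩ := CharacterModule.dual_surjective_of_injective Fq hFq φq.toAddMonoidHom
  refine ⟨ψ, fun x => ?_⟩
  exact DFunLike.congr_fun hψ (Submodule.Quotient.mk x)

lemma exists_character_separating (S : AddSubgroup G) {x : G} (hx : x ∉ S) :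
    ∃ χ : CharacterModule G, (∀ s ∈ S, χ s = 0) ∧ χ x ≠ 0 := by
  have hx' : (QuotientAddGroup.mk' S) x ≠ 0 := by
    simpa using hx
  obtain ⟨c, hc⟩ := CharacterModule.exists_character_apply_ne_zero_of_ne_zero hx'
  refine ⟨AddMonoidHom.comp c (QuotientAddGroup.mk' S), fun s hs => ?_, hc⟩
  have : (QuotientAddGroup.mk' S) s = 0 := by simpa using hs
  change c _ = 0
  rw [this, map_zero]

lemma character_add_apply (φ ψ : CharacterModule G) (x : G) : (φ + ψ) x = φ x + ψ x := rfl

lemma character_sum_apply {ι : Type*} (s : Finset ι) (φ : ι → CharacterModule G) (x : G) :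
    (∑ i ∈ s, φ i) x = ∑ i ∈ s, φ i x :=
  map_sum (AddMonoidHom.eval (M := G) (N := AddCircle (1 : ℚ)) x) φ s

end Characters

variable {R : Type u} [Ring R]

/-! ### Balanced pairings and duals of maps -/

section Adjunction

variable {M : Type u} [AddCommGroup M] [Module R M]
variable {E F : Type u} [AddCommGroup E] [Module Rᵐᵒᵖ E] [AddCommGroup F] [Module Rᵐᵒᵖ F]

/-- Swapping the arguments of a balanced pairing `E × M → ℚ/ℤ`. -/
def swapLeft (h : E →ₗ[Rᵐᵒᵖ] CharacterModule M) : M →ₗ[R] CharacterModule E where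
  toFun x := AddMonoidHom.mk' (fun e => h e x) fun a b => by
    rw [map_add]; rfl
  map_add' x y := CharacterModule.ext _ fun e => map_add (h e) x y
  map_smul' r x := CharacterModule.ext _ fun e => by
    change h e (r • x) = h (op r • e) x
    rw [h.map_smul]; rfl

/-- Swapping the arguments of a balanced pairing `M × E → ℚ/ℤ`. -/
def swapRight (θ : M →ₗ[R] CharacterModule E) : E →ₗ[Rᵐᵒᵖ] CharacterModule M where
  toFun e := AddMonoidHom.mk' (fun x => θ x e) fun a b => by
    rw [map_add]; rfl
  map_add' x y := CharacterModule.ext _ fun e => map_add (θ e) x y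
  map_smul' r x := CharacterModule.ext _ fun e => by
    change θ e (r • x) = θ (unop r • e) x
    rw [θ.map_smul]; rfl

/-- The dual of a map of right modules. -/
def dualLeft (p : E →ₗ[Rᵐᵒᵖ] F) : CharacterModule F →ₗ[R] CharacterModule E where
  toFun φ := AddMonoidHom.comp φ p.toAddMonoidHom
  map_add' _ _ := rfl
  map_smul' r φ := CharacterModule.ext _ fun e => by
    change φ (op r • p e) = φ (p (op r • e))
    rw [p.map_smul]

variable {N : Type u} [AddCommGroup N] [Module R N]

/-- The dual of a map of left modules. -/
def dualRight (p : M →ₗ[R] N) : CharacterModule N →ₗ[Rᵐᵒᵖ] CharacterModule M where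
  toFun φ := AddMonoidHom.comp φ p.toAddMonoidHom
  map_add' _ _ := rfl
  map_smul' r φ := CharacterModule.ext _ fun e => by
    change φ (unop r • p e) = φ (p (unop r • e))
    rw [p.map_smul]

end Adjunction

/-! ### Evaluation characters and finitely presented modules -/

section Evaluation

variable {C : Type u} [AddCommGroup C] [Module R C]

/-- The character `g ↦ w (g c)` of `Hom_R(C, N)`. -/
def evalChar {N : Type u} [AddCommGroup N] [Module R N] (w : CharacterModule N) (c : C) :
    CharacterModule (C →ₗ[R] N) :=
  AddMonoidHom.mk' (fun g => w (g c)) fun g h => by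
    rw [LinearMap.add_apply, map_add]

lemma evalChar_apply {N : Type u} [AddCommGroup N] [Module R N] (w : CharacterModule N) (c : C)
    (g : C →ₗ[R] N) : evalChar w c g = w (g c) := rfl

variable {ι : Type u} {N : ι → Type u} [∀ j, AddCommGroup (N j)] [∀ j, Module R (N j)]

/-- The map `C → Hom_ℤ(∏ⱼ Hom_ℤ(Nⱼ, ℚ/ℤ), ℚ/ℤ)` induced by a character of
`∏ⱼ Hom_ℤ(Hom_R(C, Nⱼ), ℚ/ℤ)`. -/
def homOfChar (Λ : CharacterModule (∀ j, CharacterModule (C →ₗ[R] N j))) :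
    C →ₗ[R] CharacterModule (∀ j, CharacterModule (N j)) where
  toFun c := AddMonoidHom.mk' (fun w => Λ fun j => evalChar (w j) c) fun v w => by
    rw [← map_add]; rfl
  map_add' c d := CharacterModule.ext _ fun w => by
    change Λ _ = Λ _ + Λ _
    rw [← map_add]
    congr 1
    funext j
    refine CharacterModule.ext _ fun g => ?_
    change w j (g (c + d)) = w j (g c) + w j (g d)
    rw [map_add, map_add]
  map_smul' r c := CharacterModule.ext _ fun w => by
    change Λ _ = Λ _
    congr 1
    funext j
    refine CharacterModule.ext _ fun g => ?_
    change w j (g (r • c)) = w j (r • g c)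
    rw [map_smul]

lemma homOfChar_apply (Λ : CharacterModule (∀ j, CharacterModule (C →ₗ[R] N j))) (c : C)
    (w : ∀ j, CharacterModule (N j)) :
    homOfChar Λ c w = Λ fun j => evalChar (w j) c := rfl

/-- Every family of characters of `Hom_R(C, Nⱼ)` is a sum of evaluations when `C` is finitely
generated. -/
lemma exists_eq_sum_evalChar [Module.Finite R C]
    (χ : ∀ j, CharacterModule (C →ₗ[R] N j)) :
    ∃ (m : ℕ) (c : Fin m → C) (w : Fin m → ∀ j, CharacterModule (N j)),
      χ = ∑ i, fun j => evalChar (w i j) (c i) := by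
  obtain ⟨m, c, hc⟩ := Module.Finite.exists_fin (R := R) (M := C)
  have key : ∀ j, ∃ ψ : CharacterModule (Fin m → N j),
      ∀ g : C →ₗ[R] N j, ψ (fun i => g (c i)) = χ j g := fun j =>
    exists_character_factor
      (AddMonoidHom.mk' (fun (g : C →ₗ[R] N j) (i : Fin m) => g (c i)) fun _ _ => rfl) (χ j)
      fun g hg => by
        have : g = 0 := LinearMap.ext_on_range hc fun i => congrFun hg i
        rw [this, map_zero]
  choose ψ hψ using key
  refine ⟨m, c, fun i j => AddMonoidHom.comp (ψ j) (AddMonoidHom.single (fun _ => N j) i), ?_⟩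
  funext j
  refine CharacterModule.ext _ fun g => ?_
  rw [Finset.sum_apply, character_sum_apply, ← hψ, ← Finset.univ_sum_single fun i => g (c i),
    map_sum]
  rfl

/-- Generators and relations in coordinates: a map out of `C` is a tuple solving a finite linear
system. -/
lemma exists_presentation (C : Type u) [AddCommGroup C] [Module R C]
    [Module.FinitePresentation R C] :
    ∃ (m k : ℕ) (c : Fin m → C) (r : Fin k → Fin m → R), Submodule.span R (Set.range c) = ⊤ ∧
      (∀ l, ∑ i, r l i • c i = 0) ∧
      ∀ (N : Type u) [AddCommGroup N] [Module R N] (n : Fin m → N),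
        (∀ l, ∑ i, r l i • n i = 0) → ∃ g : C →ₗ[R] N, ∀ i, g (c i) = n i := by
  obtain ⟨m, k, f, g, hf, hg⟩ := Module.FinitePresentation.exists_fin' R C
  have hfv : ∀ v, f v = ∑ i, v i • f (Pi.single i 1) := fun v =>
    (f.pi_apply_eq_sum_univ v).trans <| Finset.sum_congr rfl fun i _ => by
      congr 2
      funext j
      simp [Pi.single_apply, eq_comm]
  refine ⟨m, k, fun i => f (Pi.single i 1), fun l => g (Pi.single l 1), ?_, fun l => ?_, ?_⟩
  · rw [eq_top_iff]
    rintro x -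
    obtain ⟨v, rfl⟩ := hf x
    rw [hfv]
    exact Submodule.sum_mem _ fun i _ =>
      Submodule.smul_mem _ _ (Submodule.subset_span ⟨i, rfl⟩)
  · rw [← hfv]
    exact hg.apply_apply_eq_zero _
  · intro N _ _ n hn
    let φ : (Fin m → R) →ₗ[R] N := Fintype.linearCombination R n
    have hφg : φ ∘ₗ g = 0 := by
      refine LinearMap.pi_ext' fun l => LinearMap.ext_ring ?_
      simpa [φ, Fintype.linearCombination_apply] using hn l
    have hker : LinearMap.ker f ≤ LinearMap.ker φ := by
      intro x hx
      obtain ⟨y, rfl⟩ := (hg x).1 hx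
      exact LinearMap.congr_fun hφg y
    refine ⟨(LinearMap.ker f).liftQ φ hker ∘ₗ
      (f.quotKerEquivOfSurjective hf).symm.toLinearMap, fun i => ?_⟩
    have : (f.quotKerEquivOfSurjective hf).symm (f (Pi.single i 1)) =
        Submodule.Quotient.mk (Pi.single i 1) := by
      rw [LinearEquiv.symm_apply_eq]; rfl
    simp [this, φ, Fintype.linearCombination_apply, Pi.single_apply]

/-- With `P = ∏ Nⱼ*`, this is the surjectivity half of `Hom_R(C, P*) ≅ (∏ Hom_R(C, Nⱼ)*)*`, which
replaces the commutation of `P ⊗ C` with products. Finitely many generators define a map `Ψ` from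
tuples in `P` to `∏ Hom_R(C, Nⱼ)*`. Its kernel consists of consequences of the finitely many
relations, on which `θ` vanishes. -/
lemma exists_homOfChar_eq [Module.FinitePresentation R C]
    (θ : C →ₗ[R] CharacterModule (∀ j, CharacterModule (N j))) :
    ∃ Λ, θ = homOfChar Λ := by
  obtain ⟨m, k, c, r, hc, hr, hex⟩ := exists_presentation (R := R) C
  let Ψ : (Fin m → ∀ j, CharacterModule (N j)) →+ ∀ j, CharacterModule (C →ₗ[R] N j) :=
    AddMonoidHom.mk' (fun w j => ∑ i, evalChar (w i j) (c i)) fun v w => by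
      funext j
      refine CharacterModule.ext _ fun g => ?_
      rw [Pi.add_apply, character_add_apply, character_sum_apply, character_sum_apply,
        character_sum_apply, ← Finset.sum_add_distrib]
      rfl
  let T : CharacterModule (Fin m → ∀ j, CharacterModule (N j)) :=
    AddMonoidHom.mk' (fun w => ∑ i, θ (c i) (w i)) fun v w => by
      rw [← Finset.sum_add_distrib]
      exact Finset.sum_congr rfl fun i _ => map_add _ _ _
  have hT : ∀ w, Ψ w = 0 → T w = 0 := by
    intro w hw
    have key : ∀ j, ∃ ψ : CharacterModule (Fin k → N j), ∀ n : Fin m → N j,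
        ψ (fun l => ∑ i, r l i • n i) = ∑ i, w i j (n i) := fun j =>
      exists_character_factor
        (AddMonoidHom.mk' (fun (n : Fin m → N j) (l : Fin k) => ∑ i, r l i • n i) fun a b => by
          funext l
          simp [Finset.sum_add_distrib])
        (AddMonoidHom.mk' (fun n : Fin m → N j => ∑ i, w i j (n i)) fun a b => by
          simp [Finset.sum_add_distrib])
        fun n hn => by
          obtain ⟨g, hg⟩ := hex (N j) n fun l => congrFun hn l
          have := DFunLike.congr_fun (congrFun hw j) g
          change (∑ i, evalChar (w i j) (c i)) g = 0 at this
          rw [character_sum_apply] at this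
          change ∑ i, w i j (n i) = 0
          rw [← this]
          exact Finset.sum_congr rfl fun i _ => by rw [evalChar_apply, hg]
    choose ψ hψ using key
    let y : Fin k → ∀ j, CharacterModule (N j) := fun l j =>
      AddMonoidHom.comp (ψ j) (AddMonoidHom.single (fun _ => N j) l)
    -- The functional `n ↦ ∑ᵢ wᵢⱼ(nᵢ)` kills all solutions of the relations, so it factors through
    -- the relation map. Reading off coordinates expresses `w` by the relations.
    have hw : ∀ i, w i = ∑ l, op (r l i) • y l := fun i => by
      funext j
      refine CharacterModule.ext _ fun n => ?_
      have := hψ j (Pi.single i n)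
      rw [Finset.sum_apply, character_sum_apply]
      rw [Finset.sum_eq_single i (fun b _ hb => by rw [Pi.single_eq_of_ne hb, map_zero])
        (fun h => absurd (Finset.mem_univ i) h), Pi.single_eq_same] at this
      rw [← this, ← Finset.univ_sum_single fun l => ∑ i', r l i' • (Pi.single i n : Fin m → N j) i',
        map_sum]
      refine Finset.sum_congr rfl fun l _ => ?_
      change ψ j _ = ψ j (Pi.single l (r l i • n))
      rw [Finset.sum_eq_single i (fun b _ hb => by rw [Pi.single_eq_of_ne hb, smul_zero])
        (fun h => absurd (Finset.mem_univ i) h), Pi.single_eq_same]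
    change ∑ i, θ (c i) (w i) = 0
    calc ∑ i, θ (c i) (w i) = ∑ i, ∑ l, (r l i • θ (c i)) (y l) :=
          Finset.sum_congr rfl fun i _ => by rw [hw i, map_sum]; rfl
      _ = ∑ l, ∑ i, (θ (r l i • c i)) (y l) := by
          rw [Finset.sum_comm]
          simp_rw [map_smul]
      _ = ∑ l, (θ (∑ i, r l i • c i)) (y l) :=
          Finset.sum_congr rfl fun l _ => by rw [map_sum, character_sum_apply]
      _ = 0 := Finset.sum_eq_zero fun l _ => by rw [hr, map_zero]; rfl
  obtain ⟨Λ, hΛ⟩ := exists_character_factor Ψ T hT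
  refine ⟨Λ, LinearMap.ext_on_range hc fun i => CharacterModule.ext _ fun w => ?_⟩
  have h1 : T (Pi.single i w) = θ (c i) w := by
    change ∑ i', θ (c i') ((Pi.single i w : Fin m → ∀ j, CharacterModule (N j)) i') = _
    rw [Finset.sum_eq_single i (fun b _ hb => by rw [Pi.single_eq_of_ne hb, map_zero])
        (fun h => absurd (Finset.mem_univ i) h), Pi.single_eq_same]
  rw [← h1, ← hΛ, homOfChar_apply]
  congr 1
  funext j
  change ∑ i', evalChar ((Pi.single i w : Fin m → ∀ j, CharacterModule (N j)) i' j) (c i') = _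
  rw [Finset.sum_eq_single i (fun b _ hb => ?_) (fun h => absurd (Finset.mem_univ i) h),
    Pi.single_eq_same]
  rw [Pi.single_eq_of_ne hb]
  rfl

end Evaluation

/-! ### Factorization criterion for `lim→ 𝓑`, and weak cokernels -/

section LimClosure

variable {R : Type u} [Ring R] {𝓑 : ObjectProperty (ModuleCat.{u} R)}

open Limits in
-- The images of the finitely many generators lift to one stage of the filtered colimit, and the
-- finitely many relations hold at a later stage.
lemma exists_factor_of_limClosure {M : ModuleCat.{u} R} (hM : limClosure 𝓑 M)
    (C : Type u) [AddCommGroup C] [Module R C] [Module.FinitePresentation R C] (g : C →ₗ[R] M) :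
    ∃ B : ModuleCat.{u} R, 𝓑 B ∧ ∃ (a : C →ₗ[R] B) (b : B →ₗ[R] M), b ∘ₗ a = g := by
  obtain ⟨J, _, _, pres, h⟩ := hM
  obtain ⟨m, k, c, r, hc, hr, hex⟩ := exists_presentation (R := R) C
  have hrep : ∀ s : Finset (Fin m), ∃ j, ∀ i ∈ s, ∃ x : pres.diag.obj j,
      pres.ι.app j x = g (c i) := by
    intro s
    induction s using Finset.induction_on with
    | empty => exact ⟨IsFiltered.nonempty.some, by simp⟩
    | insert a s _ ih =>
      obtain ⟨j, hj⟩ := ih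
      obtain ⟨j', x', hx'⟩ := Concrete.isColimit_exists_rep _ pres.isColimit (g (c a))
      refine ⟨IsFiltered.max j j', fun i hi => ?_⟩
      rcases Finset.mem_insert.1 hi with rfl | hi
      · refine ⟨pres.diag.map (IsFiltered.rightToMax j j') x', ?_⟩
        rw [← hx', ← ConcreteCategory.comp_apply, pres.ι.naturality]
        rfl
      · obtain ⟨x, hx⟩ := hj i hi
        refine ⟨pres.diag.map (IsFiltered.leftToMax j j') x, ?_⟩
        rw [← hx, ← ConcreteCategory.comp_apply, pres.ι.naturality]
        rfl
  obtain ⟨j, hj⟩ := hrep Finset.univ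
  choose x hx using fun i => hj i (Finset.mem_univ i)
  have hkill : ∀ s : Finset (Fin k), ∃ (j' : J) (f : j ⟶ j'), ∀ l ∈ s,
      pres.diag.map f (∑ i, r l i • x i) = 0 := by
    intro s
    induction s using Finset.induction_on with
    | empty => exact ⟨j, 𝟙 _, by simp⟩
    | insert a s _ ih =>
      obtain ⟨j', f, hf⟩ := ih
      have h0 : pres.ι.app j' (pres.diag.map f (∑ i, r a i • x i)) = pres.ι.app j' 0 := by
        rw [← ConcreteCategory.comp_apply, pres.ι.naturality, map_zero]
        change pres.ι.app j (∑ i, r a i • x i) = 0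
        rw [map_sum]
        simp_rw [map_smul, hx]
        rw [← map_zero g, ← hr a, map_sum]
        simp_rw [map_smul]
      obtain ⟨j'', u, v, huv⟩ := Concrete.isColimit_exists_of_rep_eq _ pres.isColimit _ _ h0
      refine ⟨j'', f ≫ u, fun l hl => ?_⟩
      rw [Functor.map_comp, ConcreteCategory.comp_apply]
      rcases Finset.mem_insert.1 hl with rfl | hl
      · rw [huv, map_zero]
      · rw [hf l hl, map_zero]
  obtain ⟨j', f, hf⟩ := hkill Finset.univ
  obtain ⟨a, ha⟩ := hex (pres.diag.obj j') (fun i => pres.diag.map f (x i)) fun l => by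
    have := hf l (Finset.mem_univ l)
    rw [map_sum] at this
    simpa only [map_smul] using this
  refine ⟨pres.diag.obj j', h j', a, (pres.ι.app j').hom, LinearMap.ext_on_range hc fun i => ?_⟩
  rw [LinearMap.comp_apply, ha, ← hx]
  change pres.ι.app j' (pres.diag.map f (x i)) = _
  rw [← ConcreteCategory.comp_apply, pres.ι.naturality]
  rfl

lemma essentiallySmall_of_finitePresentation
    (h : ∀ M : ModuleCat.{u} R, 𝓑 M → Module.FinitePresentation R M) :
    ObjectProperty.EssentiallySmall.{u} 𝓑 where
  exists_small_le' := by
    refine ⟨ObjectProperty.ofObj fun x : Σ n : ℕ, Submodule R (Fin n → R) =>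
      ModuleCat.of R ((Fin x.1 → R) ⧸ x.2), inferInstance, fun M hM => ?_⟩
    have := h M hM
    obtain ⟨n, K, e, -⟩ := Module.FinitePresentation.exists_fin R M
    exact ⟨_, ⟨(⟨n, K⟩ : Σ n : ℕ, Submodule R (Fin n → R))⟩, ⟨e.toModuleIso⟩⟩

lemma finitePresentation_quotient_range {B C : Type u} [AddCommGroup B] [Module R B]
    [AddCommGroup C] [Module R C] [Module.FinitePresentation R B] [Module.Finite R C]
    (i : C →ₗ[R] B) : Module.FinitePresentation R (B ⧸ LinearMap.range i) :=
  Module.finitePresentation_of_surjective (LinearMap.range i).mkQ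
    (Submodule.mkQ_surjective _) (by
      rw [Submodule.ker_mkQ]
      exact Module.Finite.iff_fg.1 inferInstance)

section Converse

variable {M : ModuleCat.{u} R}

/-- The cokernel of `i` is finitely presented and still maps to `M`, so that map factors through an
object of `𝓑`. This yields both the coequalizing arrows and the injectivity of the comparison map.
-/
lemma exists_arrow_kill (h𝓑 : ∀ M : ModuleCat.{u} R, 𝓑 M → Module.FinitePresentation R M)
    (H : ∀ (C : Type u) [AddCommGroup C] [Module R C] [Module.FinitePresentation R C]
      (g : C →ₗ[R] M), ∃ B : ModuleCat.{u} R, 𝓑 B ∧ ∃ (a : C →ₗ[R] B) (b : B →ₗ[R] M),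
        b ∘ₗ a = g)
    (k : CostructuredArrow 𝓑.ι M) (C : Type u) [AddCommGroup C] [Module R C] [Module.Finite R C]
    (i : C →ₗ[R] k.left.obj) (hi : k.hom.hom ∘ₗ i = 0) :
    ∃ (k' : CostructuredArrow 𝓑.ι M) (f : k ⟶ k'), f.left.hom.hom ∘ₗ i = 0 := by
  have := h𝓑 _ k.left.property
  have := finitePresentation_quotient_range i
  obtain ⟨B, hB, a, b, hab⟩ := H (k.left.obj ⧸ LinearMap.range i)
    ((LinearMap.range i).liftQ k.hom.hom (by
      rintro _ ⟨x, rfl⟩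
      exact LinearMap.congr_fun hi x))
  refine ⟨CostructuredArrow.mk (Y := (⟨B, hB⟩ : 𝓑.FullSubcategory)) (ModuleCat.ofHom b),
    CostructuredArrow.homMk (ObjectProperty.homMk
      (ModuleCat.ofHom (a ∘ₗ (LinearMap.range i).mkQ))) ?_, ?_⟩
  · ext x
    exact LinearMap.congr_fun hab (Submodule.Quotient.mk x)
  · ext x
    change a (Submodule.Quotient.mk (i x)) = 0
    rw [(Submodule.Quotient.mk_eq_zero (LinearMap.range i)).2 ⟨x, rfl⟩, map_zero]

lemma arrow_hom_apply {k k' : CostructuredArrow 𝓑.ι M} (f : k ⟶ k') (z : k.left.obj) :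
    k'.hom.hom (f.left.hom.hom z) = k.hom.hom z :=
  LinearMap.congr_fun (congrArg ModuleCat.Hom.hom (CostructuredArrow.w f)) z

/-- As in Lazard's theorem, `M` is the colimit of the canonical diagram of all maps from objects of
`𝓑` to `M`. Sums give upper bounds, and `kill` applied to a difference equalizes parallel arrows. -/
lemma limClosure_of_exists_factor (h𝓑 : IsAdditiveFPSubcategory 𝓑)
    (H : ∀ (C : Type u) [AddCommGroup C] [Module R C] [Module.FinitePresentation R C]
      (g : C →ₗ[R] M), ∃ B : ModuleCat.{u} R, 𝓑 B ∧ ∃ (a : C →ₗ[R] B) (b : B →ₗ[R] M),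
        b ∘ₗ a = g) :
    limClosure 𝓑 M := by
  have kill := exists_arrow_kill h𝓑.finitePresentation H
  have : ObjectProperty.EssentiallySmall.{u} 𝓑 :=
    essentiallySmall_of_finitePresentation h𝓑.finitePresentation
  have : Nonempty (CostructuredArrow 𝓑.ι M) := by
    obtain ⟨Z, hZ, -⟩ := h𝓑.exists_zero
    exact ⟨CostructuredArrow.mk (Y := (⟨Z, hZ⟩ : 𝓑.FullSubcategory)) (ModuleCat.ofHom 0)⟩
  have : IsFiltered (CostructuredArrow 𝓑.ι M) :=
    { cocone_objs := fun k k' => by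
        obtain ⟨P, hP, ⟨e⟩⟩ := h𝓑.exists_sum _ _ k.left.property k'.left.property
        refine ⟨CostructuredArrow.mk (Y := (⟨P, hP⟩ : 𝓑.FullSubcategory))
          (ModuleCat.ofHom (LinearMap.coprod k.hom.hom k'.hom.hom ∘ₗ e.toLinearMap)),
          CostructuredArrow.homMk (ObjectProperty.homMk
            (ModuleCat.ofHom (e.symm.toLinearMap ∘ₗ LinearMap.inl R _ _))) ?_,
          CostructuredArrow.homMk (ObjectProperty.homMk
            (ModuleCat.ofHom (e.symm.toLinearMap ∘ₗ LinearMap.inr R _ _))) ?_, trivial⟩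
        · ext x
          change LinearMap.coprod k.hom.hom k'.hom.hom (e (e.symm (x, 0))) = k.hom.hom x
          simp
        · ext x
          change LinearMap.coprod k.hom.hom k'.hom.hom (e (e.symm (0, x))) = k'.hom.hom x
          simp
      cocone_maps := fun k k' f g => by
        have := h𝓑.finitePresentation _ k.left.property
        obtain ⟨k'', v, hv⟩ := kill k' k.left.obj (f.left.hom.hom - g.left.hom.hom) (by
          ext x
          refine (map_sub k'.hom.hom _ _).trans (sub_eq_zero.2 ?_)
          exact (arrow_hom_apply f x).trans (arrow_hom_apply g x).symm)
        refine ⟨k'', v, ?_⟩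
        ext x
        have := LinearMap.congr_fun hv x
        rw [LinearMap.comp_apply, LinearMap.sub_apply, map_sub] at this
        exact sub_eq_zero.1 this
      nonempty := this }
  have surj : ∀ x : M, ∃ (k : CostructuredArrow 𝓑.ι M) (z : k.left.obj), k.hom.hom z = x := by
    intro x
    obtain ⟨B, hB, a, b, hab⟩ := H R (LinearMap.toSpanSingleton R M x)
    refine ⟨CostructuredArrow.mk (Y := (⟨B, hB⟩ : 𝓑.FullSubcategory)) (ModuleCat.ofHom b),
      a 1, ?_⟩
    have := LinearMap.congr_fun hab 1
    simpa using this
  choose k z hkz using surj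
  have nat : ∀ (s : Limits.Cocone (CostructuredArrow.proj 𝓑.ι M ⋙ 𝓑.ι))
      {k k' : CostructuredArrow 𝓑.ι M} (f : k ⟶ k') (x : k.left.obj),
      (s.ι.app k').hom (f.left.hom.hom x) = (s.ι.app k).hom x := fun s k k' f x =>
    LinearMap.congr_fun (congrArg ModuleCat.Hom.hom (s.w f)) x
  have zero : ∀ (s : Limits.Cocone (CostructuredArrow.proj 𝓑.ι M ⋙ 𝓑.ι))
      (k : CostructuredArrow 𝓑.ι M) (x : k.left.obj), k.hom.hom x = 0 →
      (s.ι.app k).hom x = 0 := by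
    intro s k x hx
    obtain ⟨k', f, hf⟩ := kill k R (LinearMap.toSpanSingleton R _ x) (by ext; simpa using hx)
    rw [← nat s f]
    have := LinearMap.congr_fun hf 1
    have hfx : f.left.hom.hom x = 0 := by simpa using this
    rw [hfx]
    exact map_zero _
  have wd : ∀ (s : Limits.Cocone (CostructuredArrow.proj 𝓑.ι M ⋙ 𝓑.ι))
      (k k' : CostructuredArrow 𝓑.ι M) (x : k.left.obj) (x' : k'.left.obj),
      k.hom.hom x = k'.hom.hom x' → (s.ι.app k).hom x = (s.ι.app k').hom x' := by
    intro s k k' x x' h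
    rw [← nat s (IsFiltered.leftToMax k k'), ← nat s (IsFiltered.rightToMax k k'),
      ← sub_eq_zero]
    refine (map_sub (s.ι.app (IsFiltered.max k k')).hom _ _).symm.trans (zero s _ _ ?_)
    refine (map_sub _ _ _).trans ?_
    rw [arrow_hom_apply, arrow_hom_apply, h, sub_self]
  let d : ∀ s : Limits.Cocone (CostructuredArrow.proj 𝓑.ι M ⋙ 𝓑.ι), M →ₗ[R] s.pt := fun s =>
    { toFun := fun x => (s.ι.app (k x)).hom (z x)
      map_add' := fun x y => by
        rw [← nat s (IsFiltered.leftToMax (k x) (k y)),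
          ← nat s (IsFiltered.rightToMax (k x) (k y))]
        refine Eq.trans (wd s _ _ _ _ ?_) (map_add (s.ι.app (IsFiltered.max (k x) (k y))).hom _ _)
        refine Eq.trans ?_ (map_add _ _ _).symm
        rw [arrow_hom_apply, arrow_hom_apply, hkz, hkz, hkz]
      map_smul' := fun r x => by
        refine Eq.trans (wd s _ _ _ _ ?_) (map_smul (s.ι.app (k x)).hom r (z x))
        refine Eq.trans ?_ (map_smul _ _ _).symm
        rw [hkz, hkz] }
  refine ObjectProperty.of_essentiallySmall_index (J := CostructuredArrow 𝓑.ι M)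
    { diag := CostructuredArrow.proj 𝓑.ι M ⋙ 𝓑.ι
      ι := { app := fun k => k.hom, naturality := fun k k' f => by
              refine (CostructuredArrow.w f).trans (Category.comp_id _).symm }
      isColimit :=
        { desc := fun s => ModuleCat.ofHom (d s)
          fac := fun s j => ?_
          uniq := fun s m hm => ?_ } } fun k => k.left.property
  · ext x
    exact wd s _ _ _ _ (hkz _)
  · ext x
    change m.hom x = (s.ι.app (k x)).hom (z x)
    rw [← hm]
    change _ = m.hom ((k x).hom.hom (z x))
    rw [hkz]

end Converse

lemma limClosure_iff (h𝓑 : IsAdditiveFPSubcategory 𝓑) (M : ModuleCat.{u} R) :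
    limClosure 𝓑 M ↔ ∀ (C : Type u) [AddCommGroup C] [Module R C]
      [Module.FinitePresentation R C] (g : C →ₗ[R] M),
      ∃ B : ModuleCat.{u} R, 𝓑 B ∧ ∃ (a : C →ₗ[R] B) (b : B →ₗ[R] M), b ∘ₗ a = g :=
  ⟨fun h C _ _ _ g => exists_factor_of_limClosure h C g,
    fun H => limClosure_of_exists_factor h𝓑 H⟩

/-- `g` is a weak cokernel of `f` in the full subcategory `𝓑`. -/
structure IsWeakCokernel (𝓑 : ObjectProperty (ModuleCat.{u} R)) {B B' B'' : ModuleCat.{u} R}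
    (f : B →ₗ[R] B') (g : B' →ₗ[R] B'') : Prop where
  mem : 𝓑 B''
  comp_eq_zero : g ∘ₗ f = 0
  exists_factor : ∀ (D : ModuleCat.{u} R) (h : B' →ₗ[R] D), 𝓑 D → h ∘ₗ f = 0 →
    ∃ l : B'' →ₗ[R] D, l ∘ₗ g = h

/-- The induced map on the finitely presented module `B' / im f` passes through some `D ∈ 𝓑`, where
the weak cokernel property applies. -/
lemma exists_factor_weakCokernel (h𝓑 : ∀ M : ModuleCat.{u} R, 𝓑 M → Module.FinitePresentation R M)
    {M : ModuleCat.{u} R} (hM : limClosure 𝓑 M) {B B' B'' : ModuleCat.{u} R} (hB : 𝓑 B)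
    (hB' : 𝓑 B') {f : B →ₗ[R] B'} {g : B' →ₗ[R] B''} (hg : IsWeakCokernel 𝓑 f g)
    (h : B' →ₗ[R] M) (hh : h ∘ₗ f = 0) : ∃ l : B'' →ₗ[R] M, l ∘ₗ g = h := by
  have := h𝓑 _ hB
  have := h𝓑 _ hB'
  have := finitePresentation_quotient_range f
  obtain ⟨D, hD, a, b, hab⟩ := exists_factor_of_limClosure hM (B' ⧸ LinearMap.range f)
    ((LinearMap.range f).liftQ h (by
      rintro _ ⟨x, rfl⟩
      exact LinearMap.congr_fun hh x))
  obtain ⟨l, hl⟩ := hg.exists_factor D (a ∘ₗ (LinearMap.range f).mkQ) hD (by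
    ext x
    change a (Submodule.Quotient.mk (f x)) = 0
    rw [(Submodule.Quotient.mk_eq_zero (LinearMap.range f)).2 ⟨x, rfl⟩, map_zero])
  refine ⟨b ∘ₗ l, ?_⟩
  rw [LinearMap.comp_assoc, hl, ← LinearMap.comp_assoc, hab, Submodule.liftQ_mkQ]

/-- The hypotheses on `𝓑` after passing to its closure under retracts. -/
structure IsRetractClosed (𝓑 : ObjectProperty (ModuleCat.{u} R)) : Prop
    extends IsAdditiveFPSubcategory 𝓑 where
  of_retract : ∀ (M N : ModuleCat.{u} R), 𝓑 N → ∀ (s : M →ₗ[R] N) (p : N →ₗ[R] M),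
    p ∘ₗ s = LinearMap.id → 𝓑 M

lemma IsRetractClosed.of_equiv (h : IsRetractClosed 𝓑) {M N : ModuleCat.{u} R} (hM : 𝓑 M)
    (e : M ≃ₗ[R] N) : 𝓑 N :=
  h.of_retract N M hM e.symm.toLinearMap e.toLinearMap (by ext; simp)

lemma IsRetractClosed.prod (h : IsRetractClosed 𝓑) {M N : ModuleCat.{u} R} (hM : 𝓑 M)
    (hN : 𝓑 N) : 𝓑 (ModuleCat.of R (M × N)) := by
  obtain ⟨P, hP, ⟨e⟩⟩ := h.exists_sum M N hM hN
  exact h.of_equiv hP e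

lemma IsRetractClosed.fin_pow (h : IsRetractClosed 𝓑) (hR : 𝓑 (ModuleCat.of R R)) (n : ℕ) :
    𝓑 (ModuleCat.of R (Fin n → R)) := by
  induction n with
  | zero =>
    obtain ⟨Z, hZ, _⟩ := h.exists_zero
    exact h.of_retract _ Z hZ 0 0 (LinearMap.ext fun x => Subsingleton.elim _ _)
  | succ n ih =>
    exact h.of_equiv (h.prod hR ih) (Fin.consLinearEquiv R (fun _ : Fin (n + 1) => R))

/-- Test for membership in `lim→ 𝓑` when `R ∈ 𝓑`. -/
lemma limClosure_of_forall_relation (h𝓑 : IsRetractClosed 𝓑) (hR : 𝓑 (ModuleCat.of R R))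
    {M : ModuleCat.{u} R}
    (H : ∀ (B B' : ModuleCat.{u} R) (f : B →ₗ[R] B') (h : B' →ₗ[R] M), 𝓑 B → 𝓑 B' →
      h ∘ₗ f = 0 → ∃ (B'' : ModuleCat.{u} R) (g : B' →ₗ[R] B'') (l : B'' →ₗ[R] M),
        𝓑 B'' ∧ g ∘ₗ f = 0 ∧ l ∘ₗ g = h) :
    limClosure 𝓑 M := by
  rw [limClosure_iff h𝓑.toIsAdditiveFPSubcategory]
  intro C _ _ _ q
  obtain ⟨m, k, c, r, hc, hr, hex⟩ := exists_presentation (R := R) C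
  let π : (Fin m → R) →ₗ[R] C := Fintype.linearCombination R c
  let ρ : (Fin k → R) →ₗ[R] (Fin m → R) := Fintype.linearCombination R r
  have hπ : ∀ i, π (Pi.single i 1) = c i := fun i => by
    simp [π, Fintype.linearCombination_apply, Pi.single_apply]
  have hρ : ∀ l, ρ (Pi.single l 1) = r l := fun i => by
    simp [ρ, Fintype.linearCombination_apply_single]
  have hπρ : π ∘ₗ ρ = 0 := LinearMap.pi_ext' fun l => LinearMap.ext_ring <| by
    change π (ρ (Pi.single l 1)) = 0
    rw [hρ]
    simpa [π, Fintype.linearCombination_apply] using hr l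
  -- Since `R ∈ 𝓑`, a free presentation of `C` lies in `𝓑`; a map that kills its relations descends
  -- to `C`.
  obtain ⟨B, g, l, hB, hg, hl⟩ := H (ModuleCat.of R (Fin k → R)) (ModuleCat.of R (Fin m → R)) ρ
    (q ∘ₗ π) (h𝓑.fin_pow hR k) (h𝓑.fin_pow hR m) (by
      rw [LinearMap.comp_assoc, hπρ, LinearMap.comp_zero])
  obtain ⟨a, ha⟩ := hex B (fun i => g (Pi.single i (1 : R))) fun j => by
    have := LinearMap.congr_fun hg (Pi.single j (1 : R))
    change g (ρ (Pi.single j 1)) = 0 at this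
    rw [hρ, LinearMap.pi_apply_eq_sum_univ g] at this
    rw [← this]
    refine Finset.sum_congr rfl fun i _ => ?_
    congr 2
    funext t
    simp [Pi.single_apply, eq_comm]
  refine ⟨B, hB, a, l, LinearMap.ext_on_range hc fun i => ?_⟩
  rw [LinearMap.comp_apply, ha]
  refine (LinearMap.congr_fun hl (Pi.single i (1 : R))).trans ?_
  change q (π (Pi.single i 1)) = _
  rw [hπ]

end LimClosure

/-! ### Consequences of the noetherian condition: chain condition, weak cokernels, coherence -/

section Noetherian

variable {R : Type u} [Ring R] {𝓑 : ObjectProperty (ModuleCat.{u} R)}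

/-- Relative injectivity passes from duals to products and then to direct summands. -/
lemma cosupport_exists_extension {F : ModuleCat.{u} Rᵐᵒᵖ} (hF : cosupport 𝓑 F) {E W : Type u}
    [AddCommGroup E] [Module Rᵐᵒᵖ E] [AddCommGroup W] [Module Rᵐᵒᵖ W] (φ : E →ₗ[Rᵐᵒᵖ] W)
    (hφ : ∀ B : ModuleCat.{u} R, 𝓑 B → ∀ h : E →ₗ[Rᵐᵒᵖ] CharacterModule B,
      ∃ h' : W →ₗ[Rᵐᵒᵖ] CharacterModule B, h' ∘ₗ φ = h) (v : E →ₗ[Rᵐᵒᵖ] F) :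
    ∃ v' : W →ₗ[Rᵐᵒᵖ] F, v' ∘ₗ φ = v := by
  obtain ⟨ι, X, hX, s, p, hps⟩ := hF
  have key : ∀ i, ∃ h' : W →ₗ[Rᵐᵒᵖ] X i, h' ∘ₗ φ = LinearMap.proj i ∘ₗ s ∘ₗ v := by
    intro i
    obtain ⟨B, hB, ⟨e⟩⟩ := hX i
    obtain ⟨h', hh'⟩ := hφ B hB (e.toLinearMap ∘ₗ LinearMap.proj i ∘ₗ s ∘ₗ v)
    refine ⟨e.symm.toLinearMap ∘ₗ h', ?_⟩
    ext x
    have := LinearMap.congr_fun hh' x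
    exact (e.symm_apply_eq).2 this
  choose h' hh' using key
  refine ⟨p ∘ₗ LinearMap.pi h', ?_⟩
  have : LinearMap.pi h' ∘ₗ φ = s ∘ₗ v := by
    refine LinearMap.ext fun x => funext fun i => ?_
    exact LinearMap.congr_fun (hh' i) x
  rw [LinearMap.comp_assoc, this, ← LinearMap.comp_assoc, hps, LinearMap.id_comp]

/-- Maps from a direct sum to the dual of a finitely presented module extend to the product. -/
lemma exists_extension_of_directSum {ι : Type u} [DecidableEq ι] (N : ι → Type u)
    [∀ j, AddCommGroup (N j)]
    [∀ j, Module R (N j)] {C : Type u} [AddCommGroup C] [Module R C]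
    [Module.FinitePresentation R C]
    (h : (⨁ j, CharacterModule (N j)) →ₗ[Rᵐᵒᵖ] CharacterModule C) :
    ∃ h' : (∀ j, CharacterModule (N j)) →ₗ[Rᵐᵒᵖ] CharacterModule C,
      h' ∘ₗ DFinsupp.coeFnLinearMap Rᵐᵒᵖ = h := by
  have key : ∀ j, ∃ μ : CharacterModule (CharacterModule (C →ₗ[R] N j)), ∀ c w,
      h (DirectSum.lof Rᵐᵒᵖ ι (fun j => CharacterModule (N j)) j w) c = μ (evalChar w c) := by
    intro j
    obtain ⟨Λ, hΛ⟩ := exists_homOfChar_eq (R := R) (C := C) (N := fun _ : PUnit.{u + 1} => N j)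
      (swapLeft (h ∘ₗ DirectSum.lof Rᵐᵒᵖ ι (fun j => CharacterModule (N j)) j ∘ₗ
        LinearMap.proj PUnit.unit))
    refine ⟨AddMonoidHom.mk' (fun v => Λ fun _ => v) fun v w => ?_, fun c w => ?_⟩
    · rw [← map_add]; rfl
    · exact DFunLike.congr_fun (LinearMap.congr_fun hΛ c) fun _ => w
  choose μ hμ using key
  obtain ⟨Λ, hΛ⟩ := exists_character_factor
    (DFinsupp.coeFnAddMonoidHom (β := fun j => CharacterModule (C →ₗ[R] N j)))
    (DirectSum.toAddMonoid (β := fun j => CharacterModule (C →ₗ[R] N j)) μ) fun x hx => by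
      have : x = 0 := DFunLike.coe_injective hx
      rw [this]
      exact map_zero _
  refine ⟨swapRight (homOfChar Λ), DirectSum.linearMap_ext _ fun j => LinearMap.ext fun w =>
    CharacterModule.ext _ fun c => ?_⟩
  change Λ (fun j' => evalChar
    ((DirectSum.lof Rᵐᵒᵖ ι (fun j => CharacterModule (N j)) j w) j') c) = _
  have h1 := hΛ (DirectSum.of (fun j => CharacterModule (C →ₗ[R] N j)) j (evalChar w c))
  have h2 : (DirectSum.toAddMonoid (β := fun j => CharacterModule (C →ₗ[R] N j)) μ)
      (DirectSum.of (fun j => CharacterModule (C →ₗ[R] N j)) j (evalChar w c)) =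
      μ j (evalChar w c) := DirectSum.toAddMonoid_of _ _ _
  refine Eq.trans ?_ ((h1.trans h2).trans (hμ j c w).symm)
  congr 1
  funext j'
  change _ = (DirectSum.of (fun j => CharacterModule (C →ₗ[R] N j)) j (evalChar w c)) j'
  rw [DirectSum.lof_eq_of]
  by_cases hj : j' = j
  · subst hj
    rw [DirectSum.of_eq_same, DirectSum.of_eq_same]
  · rw [DirectSum.of_eq_of_ne _ _ _ hj, DirectSum.of_eq_of_ne _ _ _ hj]
    rfl

lemma charDuals_charRight {B : ModuleCat.{u} R} (hB : 𝓑 B) : charDuals 𝓑 (charRight B) :=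
  ⟨B, hB, ⟨LinearEquiv.refl _ _⟩⟩

lemma cosupport_charRight {B : ModuleCat.{u} R} (hB : 𝓑 B) : cosupport 𝓑 (charRight B) :=
  ⟨PUnit, fun _ => charRight B, fun _ => charDuals_charRight hB,
    LinearMap.pi fun _ => LinearMap.id, LinearMap.proj PUnit.unit, rfl⟩

/-- If `R` is `𝓑`-noetherian, the finitely supported families split off the product. -/
lemma exists_finitelySupported_retraction
    (h𝓑 : ∀ M : ModuleCat.{u} R, 𝓑 M → Module.FinitePresentation R M) (hN : IsNoetherianFor 𝓑)
    (D : ULift.{u} ℕ → ModuleCat.{u} R) (hD : ∀ n, 𝓑 (D n)) :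
    ∃ p : (∀ n, CharacterModule (D n)) →ₗ[Rᵐᵒᵖ] (∀ n, CharacterModule (D n)),
      (∀ w, ∃ k : ℕ, ∀ n, k ≤ n.down → p w n = 0) ∧
      ∀ w (k : ℕ), (∀ n, k ≤ n.down → w n = 0) → p w = w := by
  classical
  obtain ⟨q, hq⟩ := cosupport_exists_extension
    (hN (ULift.{u} ℕ) (fun n => charRight (D n)) fun n => cosupport_charRight (hD n))
    (DFinsupp.coeFnLinearMap Rᵐᵒᵖ (β := fun n => CharacterModule (D n)))
    (fun B hB h => by
      have := h𝓑 B hB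
      exact exists_extension_of_directSum (fun n => D n) h) LinearMap.id
  have hq' : ∀ x : Π₀ n, CharacterModule (D n), q (fun n => x n) = x := fun x =>
    LinearMap.congr_fun hq x
  refine ⟨DFinsupp.coeFnLinearMap Rᵐᵒᵖ (β := fun n => CharacterModule (D n)) ∘ₗ q,
    fun w => ?_, fun w k hw => ?_⟩
  · let x : Π₀ n, CharacterModule (D n) := q w
    refine ⟨x.support.sup (fun n => n.down) + 1, fun n hn => ?_⟩
    change x n = 0
    by_contra hne
    have : n.down ≤ x.support.sup (fun n => n.down) :=
      Finset.le_sup (f := fun n : ULift.{u} ℕ => n.down) (DFinsupp.mem_support_iff.2 hne)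
    omega
  · let x : Π₀ n, CharacterModule (D n) :=
      DFinsupp.mk ((Finset.range k).map Equiv.ulift.symm.toEmbedding) fun n => w n
    have hx : ∀ n, x n = w n := by
      intro n
      by_cases hn : n ∈ (Finset.range k).map Equiv.ulift.{u}.symm.toEmbedding
      · exact DFinsupp.mk_of_mem hn
      · refine (DFinsupp.mk_of_notMem hn).trans (hw n ?_).symm
        by_contra hlt
        exact hn (Finset.mem_map.2 ⟨n.down, Finset.mem_range.2 (not_le.1 hlt), rfl⟩)
    have hxw : (fun n => x n) = w := funext hx
    have := hq' x
    rw [hxw] at this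
    funext n
    change (q w : Π₀ n, CharacterModule (D n)) n = w n
    rw [this]
    exact hx n

/-- Ascending chain condition on maps out of an object of `𝓑`. -/
lemma exists_factor_succ
    (h𝓑 : ∀ M : ModuleCat.{u} R, 𝓑 M → Module.FinitePresentation R M) (hN : IsNoetherianFor 𝓑)
    {B : ModuleCat.{u} R} (hB : 𝓑 B) (D : ℕ → ModuleCat.{u} R) (hD : ∀ n, 𝓑 (D n))
    (f : ∀ n, B →ₗ[R] D n) (hf : ∀ n, ∃ g : D (n + 1) →ₗ[R] D n, f n = g ∘ₗ f (n + 1)) :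
    ∃ n, ∃ g : D n →ₗ[R] D (n + 1), f (n + 1) = g ∘ₗ f n := by
  by_contra! hne
  have hle : ∀ m n, m ≤ n → ∃ g : D n →ₗ[R] D m, f m = g ∘ₗ f n := by
    intro m n hmn
    induction n, hmn using Nat.le_induction with
    | base => exact ⟨LinearMap.id, rfl⟩
    | succ n _ ih =>
      obtain ⟨g, hg⟩ := ih
      obtain ⟨g', hg'⟩ := hf n
      exact ⟨g ∘ₗ g', by rw [hg, hg', LinearMap.comp_assoc]⟩
  -- Suppose the chain never stabilizes. Then some character `χₙ` detects `fₙ₊₁` but kills every map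
  -- that factors through an earlier `fₘ`.
  have hχ : ∀ n, ∃ χ : CharacterModule (B →ₗ[R] D (n + 1)),
      (∀ m, m ≤ n → ∀ g : D m →ₗ[R] D (n + 1), χ (g ∘ₗ f m) = 0) ∧ χ (f (n + 1)) ≠ 0 := by
    intro n
    obtain ⟨χ, h1, h2⟩ := exists_character_separating
      (AddMonoidHom.range (AddMonoidHom.mk' (fun g : D n →ₗ[R] D (n + 1) => g ∘ₗ f n)
        fun a b => LinearMap.add_comp _ _ _)) (x := f (n + 1)) (by
          rintro ⟨g, hg⟩
          exact hne n g hg.symm)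
    refine ⟨χ, fun m hm g => ?_, h2⟩
    obtain ⟨g', hg'⟩ := hle m n hm
    exact h1 _ ⟨g ∘ₗ g', by rw [hg']; rfl⟩
  choose χ hχ0 hχ1 using hχ
  have := h𝓑 B hB
  obtain ⟨m, c, w, hw⟩ := exists_eq_sum_evalChar (R := R) (C := B)
    (N := fun n : ULift.{u} ℕ => D (n.down + 1)) fun n => χ n.down
  have hw' : ∀ (j : ULift.{u} ℕ) (g : B →ₗ[R] D (j.down + 1)),
      ∑ i, w i j (g (c i)) = χ j.down g := by
    intro j g
    have := DFunLike.congr_fun (congrFun hw j) g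
    rw [this, Finset.sum_apply, character_sum_apply]
    rfl
  obtain ⟨p, hp0, hp1⟩ := exists_finitelySupported_retraction h𝓑 hN
    (fun n : ULift.{u} ℕ => D (n.down + 1)) fun n => hD _
  choose k hk using hp0
  -- At this index all `p (wᵢ)` vanish. Truncating `wᵢ` to the coordinates `≤ n` does not change `∑ᵢ
  -- wᵢ ⊗ fₙ₊₁(cᵢ)`, because `χⱼ` kills maps through `fₙ₊₁` for `j > n`. But `p` fixes the
  -- truncations, so the `n`-th coordinate also gives `χₙ(fₙ₊₁) ≠ 0`.
  let n : ℕ := Finset.univ.sup fun i => k (w i)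
  have := h𝓑 _ (hD (n + 1))
  obtain ⟨Λ, hΛ⟩ := exists_homOfChar_eq (R := R) (C := D (n + 1))
    (N := fun n : ULift.{u} ℕ => D (n.down + 1))
    (swapLeft (LinearMap.proj (ULift.up n) ∘ₗ p))
  have hΛ' : ∀ (w : ∀ n : ULift.{u} ℕ, CharacterModule (D (n.down + 1))) (x : D (n + 1)),
      p w (ULift.up n) x = Λ fun j => evalChar (w j) x := fun w x =>
    DFunLike.congr_fun (LinearMap.congr_fun hΛ x) w
  let w' : Fin m → ∀ n : ULift.{u} ℕ, CharacterModule (D (n.down + 1)) := fun i j =>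
    if j.down ≤ n then w i j else 0
  have h1 : ∑ i, p (w i) (ULift.up n) (f (n + 1) (c i)) = 0 := by
    refine Finset.sum_eq_zero fun i _ => ?_
    rw [hk (w i) (ULift.up n) (Finset.le_sup (f := fun i => k (w i)) (Finset.mem_univ i))]
    rfl
  have h2 : ∑ i, p (w' i) (ULift.up n) (f (n + 1) (c i)) = χ n (f (n + 1)) := by
    rw [← hw' (ULift.up n)]
    refine Finset.sum_congr rfl fun i _ => ?_
    rw [hp1 (w' i) (n + 1) fun j hj => if_neg (by omega)]
    change (if n ≤ n then w i (ULift.up n) else 0) _ = _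
    rw [if_pos le_rfl]
  refine hχ1 n (h2.symm.trans (Eq.trans ?_ h1))
  simp_rw [hΛ', ← map_sum]
  congr 1
  funext j
  rw [Finset.sum_apply, Finset.sum_apply]
  by_cases hj : j.down ≤ n
  · refine Finset.sum_congr rfl fun i _ => ?_
    change evalChar (if j.down ≤ n then w i j else 0) _ = _
    rw [if_pos hj]
  · refine CharacterModule.ext _ fun g => ?_
    rw [character_sum_apply, character_sum_apply]
    refine Eq.trans (Finset.sum_eq_zero fun i _ => ?_) (Eq.symm ?_)
    · change evalChar (if j.down ≤ n then w i j else 0) _ g = _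
      rw [if_neg hj]
      rfl
    · exact (hw' j (g ∘ₗ f (n + 1))).trans (hχ0 _ _ (by omega) g)

/-- A property of maps from `B` to objects of `𝓑` which is stable under pairing is generated by a
single map. -/
lemma exists_generating_map (h𝓑 : IsRetractClosed 𝓑) (hN : IsNoetherianFor 𝓑)
    {B : ModuleCat.{u} R} (hB : 𝓑 B) (P : ∀ D : ModuleCat.{u} R, (B →ₗ[R] D) → Prop)
    (h0 : ∀ D : ModuleCat.{u} R, P D 0)
    (hP : ∀ (D D' : ModuleCat.{u} R) (f : B →ₗ[R] D) (f' : B →ₗ[R] D'), P D f → P D' f' →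
      P (ModuleCat.of R (D × D')) (f.prod f')) :
    ∃ (D : ModuleCat.{u} R) (f : B →ₗ[R] D), 𝓑 D ∧ P D f ∧
      ∀ (D' : ModuleCat.{u} R) (f' : B →ₗ[R] D'), 𝓑 D' → P D' f' →
        ∃ l : D →ₗ[R] D', l ∘ₗ f = f' := by
  by_contra! hne
  let X := {x : Σ D : ModuleCat.{u} R, (B →ₗ[R] D) // 𝓑 x.1 ∧ P x.1 x.2}
  have hstep : ∀ x : X, ∃ y : X, (∃ g : y.1.1 →ₗ[R] x.1.1, x.1.2 = g ∘ₗ y.1.2) ∧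
      ∀ g : x.1.1 →ₗ[R] y.1.1, y.1.2 ≠ g ∘ₗ x.1.2 := by
    rintro ⟨⟨D, f⟩, hD, hf⟩
    obtain ⟨D', f', hD', hf', hno⟩ := hne D f hD hf
    -- Pairing `f` with an `f'` that it does not generate is a strict step up in the factorization
    -- order.
    refine ⟨⟨⟨ModuleCat.of R (D × D'), f.prod f'⟩, h𝓑.prod hD hD', hP _ _ _ _ hf hf'⟩,
      ⟨LinearMap.fst R D D', ?_⟩, fun g hg => ?_⟩
    · exact (LinearMap.fst_prod f f').symm
    · refine hno (LinearMap.snd R D D' ∘ₗ g) ?_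
      rw [LinearMap.comp_assoc]
      refine (congrArg (fun t => LinearMap.snd R D D' ∘ₗ t) hg).symm.trans ?_
      exact LinearMap.snd_prod f f'
  choose next hnext1 hnext2 using hstep
  let x : ℕ → X := fun n => Nat.rec ⟨⟨B, 0⟩, hB, h0 B⟩ (fun _ y => next y) n
  obtain ⟨n, g, hg⟩ := exists_factor_succ h𝓑.finitePresentation hN hB (fun n => (x n).1.1)
    (fun n => (x n).2.1) (fun n => (x n).1.2) fun n => hnext1 (x n)
  exact hnext2 (x n) g hg

lemma exists_weakCokernel (h𝓑 : IsRetractClosed 𝓑) (hN : IsNoetherianFor 𝓑)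
    {B B' : ModuleCat.{u} R} (hB' : 𝓑 B') (f : B →ₗ[R] B') :
    ∃ (B'' : ModuleCat.{u} R) (g : B' →ₗ[R] B''), IsWeakCokernel 𝓑 f g := by
  obtain ⟨D, g, hD, hg, h⟩ := exists_generating_map h𝓑 hN hB' (fun D g => g ∘ₗ f = 0)
    (fun D => LinearMap.zero_comp f) fun D D' g g' hg hg' => by
      ext x
      · exact LinearMap.congr_fun hg x
      · exact LinearMap.congr_fun hg' x
  exact ⟨D, g, hD, hg, h⟩

lemma isCoherentFor_of_isNoetherianFor (h𝓑 : IsRetractClosed 𝓑) (hR : 𝓑 (ModuleCat.of R R))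
    (hN : IsNoetherianFor 𝓑) : IsCoherentFor 𝓑 := by
  intro ι X hX
  refine limClosure_of_forall_relation h𝓑 hR fun B B' f h hB hB' hh => ?_
  obtain ⟨B'', g, hg⟩ := exists_weakCokernel h𝓑 hN hB' f
  choose l hl using fun i => exists_factor_weakCokernel h𝓑.finitePresentation (hX i) hB hB' hg
    (LinearMap.proj i ∘ₗ h) (by
      ext x
      exact congrFun (LinearMap.congr_fun hh x) i)
  refine ⟨B'', g, LinearMap.pi l, hg.mem, hg.comp_eq_zero, ?_⟩
  refine LinearMap.ext fun x => funext fun i => ?_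
  exact LinearMap.congr_fun (hl i) x

/-- The sequence `Hom(B'', Nⱼ) → Hom(B', Nⱼ) → Hom(B, Nⱼ)` is exact at the middle term. This
survives dualizing, taking products and dualizing again, and `exists_homOfChar_eq` translates it
back to maps into the double dual. -/
lemma exists_factor_of_weakCokernel_prod {ι : Type u} {N : ι → ModuleCat.{u} R}
    (hNB : ∀ j, 𝓑 (N j)) {B B' B'' : ModuleCat.{u} R} [Module.Finite R B]
    [Module.FinitePresentation R B'] {f : B →ₗ[R] B'} {g : B' →ₗ[R] B''}
    (hg : IsWeakCokernel 𝓑 f g) (h : B' →ₗ[R] CharacterModule (∀ j, CharacterModule (N j)))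
    (hh : h ∘ₗ f = 0) :
    ∃ l : B'' →ₗ[R] CharacterModule (∀ j, CharacterModule (N j)), l ∘ₗ g = h := by
  obtain ⟨Λ, rfl⟩ := exists_homOfChar_eq h
  obtain ⟨Λ', hΛ'⟩ := exists_character_factor
    (AddMonoidHom.mk' (fun (v : ∀ j, CharacterModule (B' →ₗ[R] N j)) j =>
      (AddMonoidHom.comp (v j) (AddMonoidHom.mk' (fun k : B'' →ₗ[R] N j => k ∘ₗ g)
        fun a b => LinearMap.add_comp _ _ _) : CharacterModule (B'' →ₗ[R] N j)))
      fun a b => rfl) Λ fun v hv => by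
        have hv' : ∀ j (k : B'' →ₗ[R] N j), v j (k ∘ₗ g) = 0 := fun j k =>
          DFunLike.congr_fun (congrFun hv j) k
        choose χ hχ using fun j => exists_character_factor
          (AddMonoidHom.mk' (fun k : B' →ₗ[R] N j => k ∘ₗ f) fun a b => LinearMap.add_comp _ _ _)
          (v j) fun k hk => by
            obtain ⟨l, rfl⟩ := hg.exists_factor (N j) k (hNB j) hk
            exact hv' j l
        obtain ⟨m, c, w, hw⟩ := exists_eq_sum_evalChar (R := R) (C := B)
          (N := fun j => N j) χ
        have : v = ∑ i, fun j => evalChar (w i j) (f (c i)) := by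
          funext j
          refine CharacterModule.ext _ fun k => ?_
          rw [← hχ j k, hw, Finset.sum_apply, Finset.sum_apply, character_sum_apply,
            character_sum_apply]
          rfl
        rw [this, map_sum]
        refine Finset.sum_eq_zero fun i _ => ?_
        exact DFunLike.congr_fun (LinearMap.congr_fun hh (c i)) (w i)
  refine ⟨homOfChar Λ', LinearMap.ext fun c => CharacterModule.ext _ fun w => ?_⟩
  exact hΛ' fun j => evalChar (w j) c

lemma limClosure_charLeft_of_cosupport (h𝓑 : IsRetractClosed 𝓑) (hR : 𝓑 (ModuleCat.of R R))
    (hN : IsNoetherianFor 𝓑) {E : ModuleCat.{u} Rᵐᵒᵖ} (hE : cosupport 𝓑 E) :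
    limClosure 𝓑 (charLeft E) := by
  obtain ⟨ι, X, hX, s, p, hps⟩ := hE
  choose N hNB e using hX
  replace e := fun i => (e i).some
  let s' : E →ₗ[Rᵐᵒᵖ] ∀ j, CharacterModule (N j) :=
    LinearMap.pi fun j => (e j).toLinearMap ∘ₗ LinearMap.proj j ∘ₗ s
  let p' : (∀ j, CharacterModule (N j)) →ₗ[Rᵐᵒᵖ] E :=
    p ∘ₗ LinearMap.pi fun j => (e j).symm.toLinearMap ∘ₗ LinearMap.proj j
  have hps' : ∀ x, p' (s' x) = x := by
    intro x
    refine Eq.trans (congrArg p ?_) (LinearMap.congr_fun hps x)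
    funext j
    exact (e j).symm_apply_apply _
  -- `E*` is a retract of `(∏ Nⱼ*)*`, so the factorization is found there and restricted along `s'`.
  refine limClosure_of_forall_relation h𝓑 hR fun B B' f h hB hB' hh => ?_
  have := h𝓑.finitePresentation _ hB
  have := h𝓑.finitePresentation _ hB'
  obtain ⟨B'', g, hg⟩ := exists_weakCokernel h𝓑 hN hB' f
  let h₀ : B' →ₗ[R] CharacterModule E := h
  have hh₀ : h₀ ∘ₗ f = 0 := hh
  obtain ⟨l, hl⟩ := exists_factor_of_weakCokernel_prod hNB hg (dualLeft p' ∘ₗ h₀) (by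
    rw [LinearMap.comp_assoc, hh₀, LinearMap.comp_zero])
  refine ⟨B'', g, dualLeft s' ∘ₗ l, hg.mem, hg.comp_eq_zero, ?_⟩
  refine LinearMap.ext fun x => CharacterModule.ext _ fun y => ?_
  refine (DFunLike.congr_fun (LinearMap.congr_fun hl x) (s' y)).trans ?_
  change h₀ x (p' (s' y)) = h₀ x y
  rw [hps']

end Noetherian

/-! ### Tensor products, modelled inside their double duals -/

section Tensor

variable {R : Type u} [Ring R] {E W : Type u} [AddCommGroup E] [Module Rᵐᵒᵖ E]
  [AddCommGroup W] [Module Rᵐᵒᵖ W] {C C' : Type u} [AddCommGroup C] [Module R C]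
  [AddCommGroup C'] [Module R C']

/-- The image of the pure tensor `e ⊗ c` in the double dual of `E ⊗[R] C`. -/
def tmul (e : E) (c : C) : CharacterModule (C →ₗ[R] CharacterModule E) :=
  AddMonoidHom.mk' (fun θ => θ c e) fun _ _ => rfl

lemma tmul_apply (e : E) (c : C) (θ : C →ₗ[R] CharacterModule E) : tmul e c θ = θ c e := rfl

lemma tmul_add (e : E) (c d : C) : tmul (R := R) e (c + d) = tmul e c + tmul e d :=
  CharacterModule.ext _ fun θ => by
    rw [character_add_apply, tmul_apply, map_add]; rfl

lemma add_tmul (e f : E) (c : C) : tmul (R := R) (e + f) c = tmul e c + tmul f c :=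
  CharacterModule.ext _ fun θ => map_add (θ c) e f

lemma zero_tmul (c : C) : tmul (R := R) (0 : E) c = 0 :=
  CharacterModule.ext _ fun θ => map_zero (θ c)

lemma tmul_zero (e : E) : tmul (R := R) e (0 : C) = 0 :=
  CharacterModule.ext _ fun θ => by rw [tmul_apply, map_zero]; rfl

lemma smul_tmul (r : R) (e : E) (c : C) : tmul (R := R) (op r • e) c = tmul e (r • c) :=
  CharacterModule.ext _ fun θ => by
    rw [tmul_apply, tmul_apply, θ.map_smul]; rfl

/-- Functoriality in the left module. -/
def mapR (E : Type u) [AddCommGroup E] [Module Rᵐᵒᵖ E] (g : C →ₗ[R] C') :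
    CharacterModule (C →ₗ[R] CharacterModule E) →+
      CharacterModule (C' →ₗ[R] CharacterModule E) :=
  AddMonoidHom.mk' (fun x => AddMonoidHom.mk' (fun θ => x (θ ∘ₗ g)) fun θ θ' => by
    rw [LinearMap.add_comp, map_add]) fun _ _ => rfl

lemma mapR_apply (g : C →ₗ[R] C') (x : CharacterModule (C →ₗ[R] CharacterModule E))
    (θ : C' →ₗ[R] CharacterModule E) : mapR E g x θ = x (θ ∘ₗ g) := rfl

lemma mapR_tmul (g : C →ₗ[R] C') (e : E) (c : C) : mapR E g (tmul e c) = tmul e (g c) := rfl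

/-- Functoriality in the right module. -/
def mapL (C : Type u) [AddCommGroup C] [Module R C] (φ : E →ₗ[Rᵐᵒᵖ] W) :
    CharacterModule (C →ₗ[R] CharacterModule E) →+
      CharacterModule (C →ₗ[R] CharacterModule W) :=
  AddMonoidHom.mk' (fun x => AddMonoidHom.mk' (fun θ => x (dualLeft φ ∘ₗ θ)) fun θ θ' => by
    rw [LinearMap.comp_add, map_add]) fun _ _ => rfl

lemma mapL_apply (φ : E →ₗ[Rᵐᵒᵖ] W) (x : CharacterModule (C →ₗ[R] CharacterModule E))
    (θ : C →ₗ[R] CharacterModule W) : mapL C φ x θ = x (dualLeft φ ∘ₗ θ) := rfl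

lemma mapL_tmul (φ : E →ₗ[Rᵐᵒᵖ] W) (e : E) (c : C) :
    mapL (R := R) C φ (tmul e c) = tmul (φ e) c := rfl

lemma mapL_mapR (φ : E →ₗ[Rᵐᵒᵖ] W) (g : C →ₗ[R] C')
    (x : CharacterModule (C →ₗ[R] CharacterModule E)) :
    mapL C' φ (mapR E g x) = mapR W g (mapL C φ x) := rfl

variable (C) in
/-- The subgroup generated by the pure tensors `k ⊗ c` with `k ∈ K`. -/
def tensorRange (K : Submodule Rᵐᵒᵖ E) :
    AddSubgroup (CharacterModule (C →ₗ[R] CharacterModule E)) :=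
  AddSubgroup.closure {x | ∃ k ∈ K, ∃ c : C, tmul k c = x}

lemma tmul_mem_tensorRange {K : Submodule Rᵐᵒᵖ E} {k : E} (hk : k ∈ K) (c : C) :
    tmul k c ∈ tensorRange (R := R) C K :=
  AddSubgroup.subset_closure ⟨k, hk, c, rfl⟩

lemma tensorRange_le {K : Submodule Rᵐᵒᵖ E}
    {S : AddSubgroup (CharacterModule (C →ₗ[R] CharacterModule E))}
    (h : ∀ k ∈ K, ∀ c : C, tmul k c ∈ S) : tensorRange C K ≤ S := by
  refine (AddSubgroup.closure_le _).2 ?_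
  rintro _ ⟨k, hk, c, rfl⟩
  exact h k hk c

lemma tensorRange_mono {K K' : Submodule Rᵐᵒᵖ E} (h : K ≤ K') :
    tensorRange (R := R) C K ≤ tensorRange C K' :=
  tensorRange_le fun _ hk c => tmul_mem_tensorRange (h hk) c

lemma mapR_mem_tensorRange {K : Submodule Rᵐᵒᵖ E} (g : C →ₗ[R] C')
    {x : CharacterModule (C →ₗ[R] CharacterModule E)} (hx : x ∈ tensorRange C K) :
    mapR E g x ∈ tensorRange C' K := by
  have : tensorRange C K ≤ (tensorRange C' K).comap (mapR E g) :=
    tensorRange_le fun k hk c => tmul_mem_tensorRange (R := R) hk (g c)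
  exact this hx

lemma tensorRange_range_le (φ : E →ₗ[Rᵐᵒᵖ] W) :
    tensorRange (R := R) C (LinearMap.range φ) ≤ (tensorRange C ⊤).map (mapL C φ) := by
  refine tensorRange_le ?_
  rintro _ ⟨e, rfl⟩ c
  exact ⟨tmul e c, tmul_mem_tensorRange Submodule.mem_top c, rfl⟩

lemma tensorRange_bot : tensorRange (R := R) C (⊥ : Submodule Rᵐᵒᵖ E) = ⊥ := by
  refine le_bot_iff.1 (tensorRange_le fun k hk c => ?_)
  rw [(Submodule.mem_bot _).1 hk, zero_tmul]
  exact zero_mem _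

lemma exists_mem_tensorRange_of_sSup {c : Set (Submodule Rᵐᵒᵖ E)} (hc : IsChain (· ≤ ·) c)
    (hne : c.Nonempty) {x : CharacterModule (C →ₗ[R] CharacterModule E)}
    (hx : x ∈ tensorRange C (sSup c)) : ∃ K ∈ c, x ∈ tensorRange C K := by
  induction hx using AddSubgroup.closure_induction with
  | mem x hx =>
    obtain ⟨k, hk, d, rfl⟩ := hx
    obtain ⟨K, hK, hkK⟩ := (Submodule.mem_sSup_of_directed hne hc.directedOn).1 hk
    exact ⟨K, hK, tmul_mem_tensorRange hkK d⟩
  | zero => exact ⟨hne.some, hne.some_mem, zero_mem _⟩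
  | add x y _ _ ihx ihy =>
    obtain ⟨K, hK, hx⟩ := ihx
    obtain ⟨K', hK', hy⟩ := ihy
    rcases hc.total hK hK' with h | h
    · exact ⟨K', hK', add_mem (tensorRange_mono h hx) hy⟩
    · exact ⟨K, hK, add_mem hx (tensorRange_mono h hy)⟩
  | neg x _ ih =>
    obtain ⟨K, hK, hx⟩ := ih
    exact ⟨K, hK, neg_mem hx⟩

/-- Scalars move across the tensor sign, so adjoining one element `d` to `K` contributes only single
pure tensors `d ⊗ c`. -/
lemma exists_eq_add_tmul (K : Submodule Rᵐᵒᵖ E) (d : E)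
    {x : CharacterModule (C →ₗ[R] CharacterModule E)}
    (hx : x ∈ tensorRange C (K ⊔ Submodule.span Rᵐᵒᵖ {d})) :
    ∃ k ∈ tensorRange C K, ∃ c : C, x = k + tmul d c := by
  have : tensorRange C (K ⊔ Submodule.span Rᵐᵒᵖ {d}) ≤ tensorRange C K ⊔
      AddMonoidHom.range (AddMonoidHom.mk' (fun c : C => tmul (R := R) d c) (tmul_add d)) := by
    refine tensorRange_le fun k hk c => ?_
    obtain ⟨y, hy, z, hz, rfl⟩ := Submodule.mem_sup.1 hk
    obtain ⟨r, rfl⟩ := Submodule.mem_span_singleton.1 hz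
    rw [add_tmul]
    refine AddSubgroup.add_mem_sup (tmul_mem_tensorRange hy c) ⟨unop r • c, ?_⟩
    exact (smul_tmul (unop r) d c).symm
  obtain ⟨k, hk, _, ⟨c, rfl⟩, h⟩ := AddSubgroup.mem_sup.1 (this hx)
  exact ⟨k, hk, c, h.symm⟩

lemma eq_zero_of_tmul_one_eq_zero {e : E} (h : tmul (R := R) e (1 : R) = 0) : e = 0 := by
  refine CharacterModule.eq_zero_of_character_apply fun χ => ?_
  have := DFunLike.congr_fun h (LinearMap.toSpanSingleton R (CharacterModule E) χ)
  rw [tmul_apply, LinearMap.toSpanSingleton_apply, one_smul] at this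
  exact this

end Tensor

/-! ### Pure maps split when the dual of the source lies in `lim→ 𝓑` -/

section Splitting

variable {R : Type u} [Ring R] {𝓑 : ObjectProperty (ModuleCat.{u} R)}

/-- Every map from `E` to the dual of an object of `𝓑` extends along `φ`. -/
def IsPureFor (𝓑 : ObjectProperty (ModuleCat.{u} R)) {E W : Type u} [AddCommGroup E]
    [Module Rᵐᵒᵖ E] [AddCommGroup W] [Module Rᵐᵒᵖ W] (φ : E →ₗ[Rᵐᵒᵖ] W) : Prop :=
  ∀ B : ModuleCat.{u} R, 𝓑 B → ∀ h : E →ₗ[Rᵐᵒᵖ] CharacterModule B,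
    ∃ h' : W →ₗ[Rᵐᵒᵖ] CharacterModule B, h' ∘ₗ φ = h

variable {E W : Type u} [AddCommGroup E] [Module Rᵐᵒᵖ E] [AddCommGroup W] [Module Rᵐᵒᵖ W]

/-- By swapping arguments, every `B → E*` lifts to `B → W*`, so elements of the double dual are
already tested on such lifts. -/
lemma IsPureFor.mapL_injective {φ : E →ₗ[Rᵐᵒᵖ] W} (hφ : IsPureFor 𝓑 φ) {B : ModuleCat.{u} R}
    (hB : 𝓑 B) {x : CharacterModule (B →ₗ[R] CharacterModule E)} (hx : mapL B φ x = 0) :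
    x = 0 := by
  refine CharacterModule.ext _ fun θ => ?_
  obtain ⟨h', hh'⟩ := hφ B hB (swapRight θ)
  have : θ = dualLeft φ ∘ₗ swapLeft h' := by
    refine LinearMap.ext fun b => CharacterModule.ext _ fun e => ?_
    exact (DFunLike.congr_fun (LinearMap.congr_fun hh' e) b).symm
  rw [this, ← mapL_apply, hx]
  rfl

lemma IsPureFor.injective (hR : 𝓑 (ModuleCat.of R R)) {φ : E →ₗ[Rᵐᵒᵖ] W} (hφ : IsPureFor 𝓑 φ) :
    Function.Injective φ := by
  refine (injective_iff_map_eq_zero φ).2 fun e he => eq_zero_of_tmul_one_eq_zero (R := R) ?_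
  refine hφ.mapL_injective hR ?_
  refine (mapL_tmul (R := R) φ e (1 : R)).trans ?_
  rw [he, zero_tmul]

/-- Exactness of `E ⊗ R → E ⊗ B → E ⊗ B'`. A character that vanishes on the image of `E ⊗ R` is a
map `θ : B → E*` with `θ ∘ f = 0`; as `E* ∈ lim→ 𝓑`, it factors through `g` and therefore kills `y`.
-/
lemma exists_eq_tmul_of_mapR_eq_zero
    (h𝓑 : ∀ M : ModuleCat.{u} R, 𝓑 M → Module.FinitePresentation R M)
    (hR : 𝓑 (ModuleCat.of R R)) {E : ModuleCat.{u} Rᵐᵒᵖ}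
    (hE : limClosure 𝓑 (charLeft E)) {B B' : ModuleCat.{u} R} (hB : 𝓑 B)
    {f : ModuleCat.of R R →ₗ[R] B} {g : B →ₗ[R] B'} (hg : IsWeakCokernel 𝓑 f g)
    {y : CharacterModule (B →ₗ[R] CharacterModule E)} (hy : y ∈ tensorRange B ⊤)
    (hgy : mapR E g y = 0) : ∃ e : E, y = tmul e (f (1 : R)) := by
  by_contra! hne
  obtain ⟨χ, hχ0, hχ1⟩ := exists_character_separating
    (AddMonoidHom.range (AddMonoidHom.mk' (fun e : E => tmul (R := R) e (f (1 : R)))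
      fun a b => add_tmul a b _)) (x := y) (by
        rintro ⟨e, he⟩
        exact hne e he.symm)
  let θ : B →ₗ[R] CharacterModule E :=
    { toFun := fun b => AddMonoidHom.mk' (fun e => χ (tmul e b)) fun a b => by
        rw [add_tmul, map_add]
      map_add' := fun a b => CharacterModule.ext _ fun e => by
        change χ _ = χ _ + χ _
        rw [tmul_add, map_add]
      map_smul' := fun r b => CharacterModule.ext _ fun e => by
        change χ (tmul e (r • b)) = χ (tmul (op r • e) b)
        rw [smul_tmul] }
  have hθ : ∀ x ∈ tensorRange B (⊤ : Submodule Rᵐᵒᵖ E), χ x - x θ = 0 := by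
    intro x hx
    have : tensorRange B (⊤ : Submodule Rᵐᵒᵖ E) ≤
        AddMonoidHom.ker (AddMonoidHom.mk' (fun x => χ x - x θ) fun a b => by
          rw [map_add, character_add_apply]; abel) :=
      tensorRange_le fun k _ c => sub_self (χ (tmul k c))
    exact this hx
  obtain ⟨ρ, hρ⟩ := exists_factor_weakCokernel h𝓑 hE hR hB hg θ (by
    refine LinearMap.ext_ring ?_
    refine CharacterModule.ext _ fun e => ?_
    exact hχ0 _ ⟨e, rfl⟩)
  let ρ' : B' →ₗ[R] CharacterModule E := ρ
  have hρ' : θ = ρ' ∘ₗ g := hρ.symm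
  refine hχ1 ?_
  rw [sub_eq_zero.1 (hθ y hy), hρ', ← mapR_apply, hgy]
  rfl

lemma IsPureFor.exists_isCompl_range (h𝓑 : IsRetractClosed 𝓑) (hR : 𝓑 (ModuleCat.of R R))
    (hN : IsNoetherianFor 𝓑) {E : ModuleCat.{u} Rᵐᵒᵖ} (hE : limClosure 𝓑 (charLeft E))
    {η : E →ₗ[Rᵐᵒᵖ] W} (hη : IsPureFor 𝓑 η) :
    ∃ K : Submodule Rᵐᵒᵖ W, IsCompl (LinearMap.range η) K := by
  let Q : Set (Submodule Rᵐᵒᵖ W) := {K | ∀ B : ModuleCat.{u} R, 𝓑 B →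
    ∀ x, x ∈ tensorRange (R := R) B K → x ∈ tensorRange B (LinearMap.range η) → x = 0}
  obtain ⟨K, -, hK⟩ := zorn_le_nonempty₀ Q (fun c hcQ hc y hy =>
    ⟨sSup c, fun B hB x hx hx' => by
      obtain ⟨K, hK, hxK⟩ := exists_mem_tensorRange_of_sSup hc ⟨y, hy⟩ hx
      exact hcQ hK B hB x hxK hx', fun z hz => le_sSup hz⟩) ⊥ fun B hB x hx _ => by
        rw [tensorRange_bot] at hx
        exact hx
  have hKQ : K ∈ Q := hK.1
  refine ⟨K, ?_, ?_⟩
  · refine Submodule.disjoint_def.2 fun x hx hxK => eq_zero_of_tmul_one_eq_zero (R := R) ?_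
    exact hKQ _ hR _ (tmul_mem_tensorRange hxK (1 : R)) (tmul_mem_tensorRange hx (1 : R))
  rw [codisjoint_iff_le_sup]
  intro a _
  -- The elements `b` with `a ⊗ b ∈ η(E) ⊗ D + K ⊗ D` correspond to maps out of `R`, so all of them
  -- are images of the single element `φ(1)`.
  obtain ⟨B₀, φ, hB₀, hφ, hgen⟩ := exists_generating_map h𝓑 hN hR
    (fun D f => tmul (R := R) a (f (1 : R)) ∈
      tensorRange D (LinearMap.range η) ⊔ tensorRange D K)
    (fun D => by
      rw [LinearMap.zero_apply, tmul_zero]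
      exact zero_mem _)
    (fun D D' f f' hf hf' => by
      have hmap : ∀ {D D' : Type u} [AddCommGroup D] [AddCommGroup D'] [Module R D] [Module R D']
          (g : D →ₗ[R] D') {x}, x ∈ tensorRange D (LinearMap.range η) ⊔ tensorRange D K →
          mapR W g x ∈ tensorRange D' (LinearMap.range η) ⊔ tensorRange D' K := by
        intro D D' _ _ _ _ g x hx
        obtain ⟨s, hs, t, ht, rfl⟩ := AddSubgroup.mem_sup.1 hx
        rw [map_add]
        exact AddSubgroup.add_mem_sup (mapR_mem_tensorRange g hs) (mapR_mem_tensorRange g ht)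
      have h1 := add_mem (hmap (LinearMap.inl R D D') hf) (hmap (LinearMap.inr R D D') hf')
      rw [mapR_tmul, mapR_tmul, ← tmul_add] at h1
      have h2 : LinearMap.inl R D D' (f (1 : R)) + LinearMap.inr R D D' (f' (1 : R)) =
          (f.prod f') (1 : R) := by simp
      rw [h2] at h1
      exact h1)
  obtain ⟨s, hs, t, ht, hst⟩ := AddSubgroup.mem_sup.1 hφ
  obtain ⟨B₁, g, hg⟩ := exists_weakCokernel h𝓑 hN hB₀ φ
  -- Applying `g` to `s + t = a ⊗ φ(1)` gives zero, so `g(s) = -g(t)` lies in both tensor ranges.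
  have hgs : mapR W g s = 0 := by
    refine hKQ B₁ hg.mem _ ?_ (mapR_mem_tensorRange g hs)
    have h1 : mapR W g s + mapR W g t = 0 := by
      rw [← map_add, hst, mapR_tmul]
      have : g (φ (1 : R)) = 0 := LinearMap.congr_fun hg.comp_eq_zero (1 : R)
      rw [this, tmul_zero]
    rw [eq_neg_of_add_eq_zero_left h1]
    exact neg_mem (mapR_mem_tensorRange g ht)
  obtain ⟨y, hy, rfl⟩ := tensorRange_range_le η hs
  obtain ⟨e, rfl⟩ := exists_eq_tmul_of_mapR_eq_zero h𝓑.finitePresentation hR hE hB₀ hg hy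
    (hη.mapL_injective hg.mem (by rw [mapL_mapR, hgs]))
  rw [mapL_tmul] at hst
  have hd : tmul (R := R) (a - η e) (φ (1 : R)) = t := by
    have h1 := add_tmul (R := R) (a - η e) (η e) (φ (1 : R))
    rw [sub_add_cancel, ← hst, add_comm] at h1
    exact (add_right_cancel h1).symm
  -- If `k + (a - η e) ⊗ b` lies in the range of `η`, then `b = l(φ(1))`, so `(a - η e) ⊗ b` is the
  -- image of `t` and already comes from `K`. Maximality then forces `a - η e ∈ K`.
  have hmem : K ⊔ Submodule.span Rᵐᵒᵖ {a - η e} ∈ Q := by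
    intro B hB x hx hx'
    obtain ⟨k, hk, b, rfl⟩ := exists_eq_add_tmul K (a - η e) hx
    have hab : tmul (R := R) a b ∈ tensorRange B (LinearMap.range η) ⊔ tensorRange B K := by
      have h1 := add_tmul (R := R) (a - η e) (η e) b
      rw [sub_add_cancel] at h1
      have h2 : tmul (R := R) a b = (k + tmul (a - η e) b + tmul (η e) b) + -k := by
        rw [h1]; abel
      rw [h2]
      exact AddSubgroup.add_mem_sup
        (add_mem hx' (tmul_mem_tensorRange (LinearMap.mem_range_self η e) b)) (neg_mem hk)
    obtain ⟨l, hl⟩ := hgen B (LinearMap.toSpanSingleton R B b) hB (by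
      have : LinearMap.toSpanSingleton R B b (1 : R) = b := by simp
      rw [this]
      exact hab)
    have hlb : l (φ (1 : R)) = b := (LinearMap.congr_fun hl (1 : R)).trans (by simp)
    have htb : tmul (R := R) (a - η e) b ∈ tensorRange B K := by
      rw [← hlb, ← mapR_tmul, hd]
      exact mapR_mem_tensorRange l ht
    exact hKQ B hB _ (add_mem hk htb) hx'
  have hle : K ⊔ Submodule.span Rᵐᵒᵖ {a - η e} ≤ K := hK.2 hmem le_sup_left
  have hae : a - η e ∈ K :=
    hle (Submodule.mem_sup_right (Submodule.mem_span_singleton_self _))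
  rw [← add_sub_cancel (η e) a]
  exact Submodule.add_mem_sup (LinearMap.mem_range_self η e) hae

lemma cosupport_of_limClosure_charLeft (h𝓑 : IsRetractClosed 𝓑) (hR : 𝓑 (ModuleCat.of R R))
    (hN : IsNoetherianFor 𝓑) {E : ModuleCat.{u} Rᵐᵒᵖ} (hE : limClosure 𝓑 (charLeft E)) :
    cosupport 𝓑 E := by
  -- Quotients of `Rⁿ` represent all objects of `𝓑` up to isomorphism by a set in the right
  -- universe.
  let ι := Σ x : (Σ n : ℕ, Submodule R (Fin n → R)),
    {h : E →ₗ[Rᵐᵒᵖ] CharacterModule ((Fin x.1 → R) ⧸ x.2) //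
      𝓑 (ModuleCat.of R ((Fin x.1 → R) ⧸ x.2))}
  let X : ι → ModuleCat.{u} Rᵐᵒᵖ := fun i =>
    charRight (ModuleCat.of R ((Fin i.1.1 → R) ⧸ i.1.2))
  let η : E →ₗ[Rᵐᵒᵖ] ∀ i, X i := LinearMap.pi fun i => i.2.1
  have hη : IsPureFor 𝓑 η := by
    intro B hB h
    have := h𝓑.finitePresentation B hB
    obtain ⟨n, K, e, -⟩ := Module.FinitePresentation.exists_fin R B
    let i : ι := ⟨⟨n, K⟩, dualRight e.symm.toLinearMap ∘ₗ h,
      h𝓑.of_equiv (N := ModuleCat.of R ((Fin n → R) ⧸ K)) hB e⟩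
    let q : (∀ i, X i) →ₗ[Rᵐᵒᵖ] CharacterModule ((Fin n → R) ⧸ K) := LinearMap.proj i
    refine ⟨dualRight e.toLinearMap ∘ₗ q, LinearMap.ext fun x => CharacterModule.ext _ fun b => ?_⟩
    change h x (e.symm (e b)) = h x b
    rw [e.symm_apply_apply]
  obtain ⟨K, hK⟩ := hη.exists_isCompl_range h𝓑 hR hN hE
  let e := LinearEquiv.ofInjective η (hη.injective hR)
  refine ⟨ι, X, fun i => charDuals_charRight i.2.2, η,
    e.symm.toLinearMap ∘ₗ Submodule.projectionOnto (LinearMap.range η) K hK,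
    LinearMap.ext fun x => ?_⟩
  change e.symm (Submodule.projectionOnto (LinearMap.range η) K hK (e x)) = x
  exact (congrArg e.symm (Submodule.projectionOnto_apply_left hK (e x))).trans
    (e.symm_apply_apply x)

end Splitting

/-! ### Reduction to a retract-closed `𝓑` containing `R` -/

section Reduction

variable {R : Type u} [Ring R] {𝓑 : ObjectProperty (ModuleCat.{u} R)}

/-- The modules which are retracts of modules from `𝓑`. -/
def retracts (𝓑 : ObjectProperty (ModuleCat.{u} R)) : ObjectProperty (ModuleCat.{u} R) :=
  fun M => ∃ B : ModuleCat.{u} R, 𝓑 B ∧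
    ∃ (s : M →ₗ[R] B) (p : B →ₗ[R] M), p ∘ₗ s = LinearMap.id

lemma le_retracts {M : ModuleCat.{u} R} (hM : 𝓑 M) : retracts 𝓑 M :=
  ⟨M, hM, LinearMap.id, LinearMap.id, rfl⟩

lemma finitePresentation_of_retract {M N : Type u} [AddCommGroup M] [Module R M]
    [AddCommGroup N] [Module R N] [Module.FinitePresentation R N] (s : M →ₗ[R] N)
    (p : N →ₗ[R] M) (hps : p ∘ₗ s = LinearMap.id) : Module.FinitePresentation R M := by
  refine Module.finitePresentation_of_surjective p
    (fun x => ⟨s x, LinearMap.congr_fun hps x⟩) ?_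
  have : LinearMap.ker p = LinearMap.range (LinearMap.id - s ∘ₗ p) := by
    ext x
    constructor
    · intro hx
      refine ⟨x, ?_⟩
      rw [LinearMap.sub_apply, LinearMap.comp_apply, LinearMap.mem_ker.1 hx]
      simp
    · rintro ⟨y, rfl⟩
      have := LinearMap.congr_fun hps (p y)
      rw [LinearMap.comp_apply] at this
      simp [this]
  rw [this]
  exact Module.Finite.iff_fg.1 inferInstance

lemma isRetractClosed_retracts (h𝓑 : IsAdditiveFPSubcategory 𝓑) :
    IsRetractClosed (retracts 𝓑) where
  finitePresentation := by
    rintro M ⟨B, hB, s, p, hps⟩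
    have := h𝓑.finitePresentation B hB
    exact finitePresentation_of_retract s p hps
  exists_zero := by
    obtain ⟨Z, hZ, h⟩ := h𝓑.exists_zero
    exact ⟨Z, le_retracts hZ, h⟩
  exists_sum := by
    rintro M N ⟨B, hB, s, p, hps⟩ ⟨B', hB', s', p', hps'⟩
    obtain ⟨P, hP, ⟨e⟩⟩ := h𝓑.exists_sum B B' hB hB'
    refine ⟨ModuleCat.of R (M × N), ⟨P, hP, e.symm.toLinearMap ∘ₗ s.prodMap s',
      p.prodMap p' ∘ₗ e.toLinearMap, LinearMap.ext fun x => ?_⟩, ⟨LinearEquiv.refl _ _⟩⟩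
    change p.prodMap p' (e (e.symm (s.prodMap s' x))) = x
    rw [e.apply_symm_apply]
    exact Prod.ext (LinearMap.congr_fun hps x.1) (LinearMap.congr_fun hps' x.2)
  of_retract := by
    rintro M N ⟨B, hB, s, p, hps⟩ s' p' hps'
    refine ⟨B, hB, s ∘ₗ s', p' ∘ₗ p, LinearMap.ext fun x => ?_⟩
    exact (congrArg p' (LinearMap.congr_fun hps (s' x))).trans (LinearMap.congr_fun hps' x)

lemma limClosure_retracts (h𝓑 : IsAdditiveFPSubcategory 𝓑) :
    limClosure (retracts 𝓑) = limClosure 𝓑 := by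
  funext M
  refine propext ?_
  rw [limClosure_iff h𝓑,
    limClosure_iff (isRetractClosed_retracts h𝓑).toIsAdditiveFPSubcategory]
  constructor
  · intro H C _ _ _ g
    obtain ⟨N, ⟨B, hB, s, p, hps⟩, a, b, hab⟩ := H C g
    refine ⟨B, hB, s ∘ₗ a, b ∘ₗ p, LinearMap.ext fun x => ?_⟩
    exact (congrArg b (LinearMap.congr_fun hps (a x))).trans (LinearMap.congr_fun hab x)
  · intro H C _ _ _ g
    obtain ⟨B, hB, h⟩ := H C g
    exact ⟨B, le_retracts hB, h⟩

lemma cosupport_retracts : cosupport (retracts 𝓑) = cosupport 𝓑 := by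
  funext E
  refine propext ⟨?_, ?_⟩
  · rintro ⟨ι, X, hX, s, p, hps⟩
    choose N hN e using hX
    choose B hB i r hri using hN
    replace e := fun j => (e j).some
    let e' : ∀ j, X j ≃ₗ[Rᵐᵒᵖ] CharacterModule (N j) := e
    refine ⟨ι, fun j => charRight (B j), fun j => charDuals_charRight (hB j),
      LinearMap.pi (fun j => dualRight (r j) ∘ₗ (e' j).toLinearMap ∘ₗ LinearMap.proj j) ∘ₗ s,
      p ∘ₗ LinearMap.pi (fun j => (e' j).symm.toLinearMap ∘ₗ dualRight (i j) ∘ₗ LinearMap.proj j),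
      LinearMap.ext fun x => ?_⟩
    refine Eq.trans (congrArg p ?_) (LinearMap.congr_fun hps x)
    funext j
    change (e' j).symm (dualRight (i j) (dualRight (r j) (e' j (s x j)))) = s x j
    rw [LinearEquiv.symm_apply_eq]
    refine CharacterModule.ext _ fun y => ?_
    exact congrArg (e' j (s x j)) (LinearMap.congr_fun (hri j) y)
  · rintro ⟨ι, X, hX, h⟩
    refine ⟨ι, X, fun j => ?_, h⟩
    obtain ⟨B, hB, e⟩ := hX j
    exact ⟨B, le_retracts hB, e⟩

/-- `R` is finitely presented, so its identity map factors through an object of `𝓑`. -/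
lemma retracts_ring (hR : limClosure 𝓑 (ModuleCat.of R R)) :
    retracts 𝓑 (ModuleCat.of R R) := by
  obtain ⟨B, hB, a, b, hab⟩ := exists_factor_of_limClosure hR R LinearMap.id
  exact ⟨B, hB, a, b, hab⟩

end Reduction

/-! ### From the two conditions back to the noetherian property -/

section DirectSum

variable {R : Type u} [Ring R] {𝓑 : ObjectProperty (ModuleCat.{u} R)}

/-- The dual of a direct sum is the product of the duals. -/
noncomputable def charLeftDirectSum {ι : Type u} [DecidableEq ι] (X : ι → ModuleCat.{u} Rᵐᵒᵖ) :
    CharacterModule (⨁ i, X i) ≃ₗ[R] (∀ i, CharacterModule (X i)) :=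
  LinearEquiv.ofBijective
    (LinearMap.pi fun i => dualLeft (DirectSum.lof Rᵐᵒᵖ ι (fun i => X i) i))
    ⟨fun _ _ h => DirectSum.addHom_ext' fun i => AddMonoidHom.ext fun x =>
        DFunLike.congr_fun (congrFun h i) x,
      fun φ => ⟨DirectSum.toAddMonoid (β := fun i => X i) φ, funext fun _ =>
        CharacterModule.ext _ fun _ => DirectSum.toAddMonoid_of _ _ _⟩⟩

lemma isNoetherianFor_of_isCoherentFor (hC : IsCoherentFor 𝓑)
    (h : ∀ E : ModuleCat.{u} Rᵐᵒᵖ, cosupport 𝓑 E ↔ limClosure 𝓑 (charLeft E)) :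
    IsNoetherianFor 𝓑 := by
  classical
  intro ι X hX
  rw [h]
  refine (ObjectProperty.ind 𝓑).prop_of_iso (LinearEquiv.toModuleIso (charLeftDirectSum X).symm)
    (hC ι (fun i => charLeft (X i)) fun i => (h _).1 (hX i))

end DirectSum

end CosupportModules

theorem theoremE {R : Type u} [Ring R]
    (𝓑 : CategoryTheory.ObjectProperty (ModuleCat.{u} R))
    (h𝓑 : CosupportModules.IsAdditiveFPSubcategory 𝓑)
    (hR : CosupportModules.limClosure 𝓑 (ModuleCat.of R R)) :
    CosupportModules.IsNoetherianFor 𝓑 ↔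
      CosupportModules.IsCoherentFor 𝓑 ∧
        ∀ E : ModuleCat.{u} Rᵐᵒᵖ,
          CosupportModules.cosupport 𝓑 E ↔
            CosupportModules.limClosure 𝓑 (CosupportModules.charLeft E) := by
  refine ⟨fun hN => ?_, fun ⟨hC, h⟩ =>
    CosupportModules.isNoetherianFor_of_isCoherentFor hC h⟩
  have h' := CosupportModules.isRetractClosed_retracts h𝓑
  have hR' := CosupportModules.retracts_ring hR
  have hL := CosupportModules.limClosure_retracts h𝓑
  have hS := CosupportModules.cosupport_retracts (𝓑 := 𝓑)
  have hN' : CosupportModules.IsNoetherianFor (CosupportModules.retracts 𝓑) := by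
    unfold CosupportModules.IsNoetherianFor
    rw [hS]
    exact hN
  constructor
  · have := CosupportModules.isCoherentFor_of_isNoetherianFor h' hR' hN'
    unfold CosupportModules.IsCoherentFor at this
    rw [hL] at this
    exact this
  · intro E
    rw [← hS, ← hL]
    exact ⟨CosupportModules.limClosure_charLeft_of_cosupport h' hR' hN',
      CosupportModules.cosupport_of_limClosure_charLeft h' hR' hN'⟩
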